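/- Let $\alpha>-\tfrac12$. On $\mathbb R_+=[0,\infty)$ put $d\mu_\alpha(x)=\frac{x^{2\alpha+1}}{2^\alpha\Gamma(\alpha+1)}\,dx$, and on $(0,\infty)\times\mathbb R_+$ put $d\nu_\alpha(a,x)=a^{2\alpha+1}\,da\,d\mu_\alpha(x)$; write $L^p_\alpha(\mathbb R_+)=L^p(\mathbb R_+,\mu_\alpha)$ (complex-valued functions) and $\|\cdot\|_{2,\mu_\alpha}$ for the norm of $L^2_\alpha(\mathbb R_+)$. Let $j_\alpha(x)=\Gamma(\alpha+1)\sum_{n\ge0}\frac{(-1)^n}{n!\,\Gamma(n+\alpha+1)}\left(\frac x2\right)^{2n}$, and for $g\in L^1_\alpha(\mathbb R_+)$ let $\mathcal H_\alpha g(\xi)=\int_0^\infty g(x)j_\alpha(x\xi)\,d\mu_\alpha(x)$. For $a>0$ and $x,y\ge0$ let $D_a g(y)=a^{\alpha+1}g(ay)$ and $$\tau_x^\alpha g(y)=\frac{\Gamma(\alpha+1)}{\Gamma(\frac12)\Gamma(\alpha+\frac12)}\int_0^\pi g\Big(\sqrt{x^2+y^2+2xy\cos\theta}\Big)(\sin\theta)^{2\alpha}\,d\theta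 .$$ A nonzero $\psi\in L^1_\alpha(\mathbb R_+)\cap L^\infty_\alpha(\mathbb R_+)$ is an admissible wavelet if $0<c_\psi:=\int_0^\infty|\mathcal H_\alpha\psi(a)|^2\frac{da}{a}<\infty$. Its Hankel wavelet transform is $$W_\psi f(a,x)=c_\psi^{-1/2}\int_0^\infty f(t)\,\overline{\tau_x^\alpha(D_a\psi)(t)}\,d\mu_\alpha(t),\qquad f\in L^2_\alpha(\mathbb R_+),\ a>0,\ x\ge0.$$ Theorem (Hirschman–Beckner entropic inequality). Let $\psi$ be an admissible wavelet with $\|\psi\|_{2,\mu_\alpha}^2\le c_\psi$. Then for every nonzero $f\in L^2_\alpha(\mathbb R_+)$ the integral $$-\int_{(0,\infty)\times\mathbb R_+}|W_\psi f(a,x)|^2\ln\left(|W_\psi f(a,x)|^2\right)d\nu_\alpha(a,x)$$ (with $0\ln 0=0$) is well defined in $(-\infty,+\infty]$, that is, its integrand $-|W_\psi f|^2\ln(|W_\psi f|^2)$ is $\nu_\alpha$-almost everywhere equal to a measurable function and the negative part of this integrand has finite integral, and $$-\int_{(0,\infty)\times\mathbb R_+}|W_\psi f(a,x)|^2\ln\left(|W_\psi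 f(a,x)|^2\right)d\nu_\alpha(a,x)\ \ge\ \|f\|_{2,\mu_\alpha}^2\,\ln\left(\frac{c_\psi}{\|\psi\|_{2,\mu_\alpha}^2\,\|f\|_{2,\mu_\alpha}^2}\right).$$ -/

import Mathlib

open MeasureTheory
open scoped ENNReal

namespace HankelWavelet

noncomputable section

/-- The measure `dμ_α(x) = x^(2α+1) / (2^α Γ(α+1)) dx` on the half-line, seen as a measure on `ℝ`
that gives no mass to the negative numbers. Functions on `ℝ₊` are represented by functions on `ℝ`;
their values at negative arguments never play a role. -/
def mu (α : ℝ) : Measure ℝ :=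
  (volume.restrict (Set.Ici (0 : ℝ))).withDensity
    (fun x => ENNReal.ofReal (x ^ (2 * α + 1) / (2 ^ α * Real.Gamma (α + 1))))

/-- The measure `dν_α(a, x) = a^(2α+1) da dμ_α(x)` on `(0, ∞) × [0, ∞)`. -/
def nu (α : ℝ) : Measure (ℝ × ℝ) :=
  ((volume.restrict (Set.Ioi (0 : ℝ))).withDensity
    (fun a => ENNReal.ofReal (a ^ (2 * α + 1)))).prod (mu α)

/-- The norm `‖f‖_{2, μ_α}`. -/
def norm2 (α : ℝ) (f : ℝ → ℂ) : ℝ := (eLpNorm f 2 (mu α)).toReal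

/-- The spherical (normalized) Bessel function
`j_α(x) = Γ(α+1) ∑ (-1)^n / (n! Γ(n+α+1)) (x/2)^(2n)`. -/
def besselj (α x : ℝ) : ℝ :=
  Real.Gamma (α + 1) *
    ∑' n : ℕ, (-1) ^ n / ((n.factorial : ℝ) * Real.Gamma (n + α + 1)) * (x / 2) ^ (2 * n)

/-- The Hankel transform `H_α f (ξ) = ∫ f(x) j_α(x ξ) dμ_α(x)` of `f ∈ L¹_α(ℝ₊)`. -/
def hankel (α : ℝ) (f : ℝ → ℂ) (ξ : ℝ) : ℂ :=
  ∫ x, f x * (besselj α (x * ξ) : ℂ) ∂(mu α)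

/-- The Hankel translation `τ_x^α f (y)`. -/
def translation (α x : ℝ) (f : ℝ → ℂ) (y : ℝ) : ℂ :=
  ((Real.Gamma (α + 1) / (Real.Gamma (1 / 2) * Real.Gamma (α + 1 / 2)) : ℝ) : ℂ) *
    ∫ θ in (0 : ℝ)..Real.pi,
      f (Real.sqrt (x ^ 2 + y ^ 2 + 2 * x * y * Real.cos θ)) *
        ((Real.sin θ ^ (2 * α) : ℝ) : ℂ)

/-- The dilation `D_a f (x) = a^(α+1) f(a x)`. -/
def dilation (α a : ℝ) (f : ℝ → ℂ) (x : ℝ) : ℂ :=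
  ((a ^ (α + 1) : ℝ) : ℂ) * f (a * x)

/-- The admissibility constant `c_ψ = ∫_0^∞ |H_α ψ (a)|² da / a`. -/
def admConst (α : ℝ) (ψ : ℝ → ℂ) : ℝ :=
  ∫ a in Set.Ioi (0 : ℝ), ‖hankel α ψ a‖ ^ 2 / a

/-- Admissible wavelets: nonzero `ψ ∈ L¹_α ∩ L^∞_α` with `0 < c_ψ < ∞`. -/
structure IsAdmissible (α : ℝ) (ψ : ℝ → ℂ) : Prop where
  ne_zero : ¬ ψ =ᵐ[mu α] 0
  memLp_one : MemLp ψ 1 (mu α)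
  memLp_top : MemLp ψ ∞ (mu α)
  const_finite : IntegrableOn (fun a : ℝ => ‖hankel α ψ a‖ ^ 2 / a) (Set.Ioi 0)
  const_pos : 0 < admConst α ψ

/-- The wavelet atom `ψ_{a,x} = c_ψ^(-1/2) τ_x (D_a ψ)`. -/
def atom (α : ℝ) (ψ : ℝ → ℂ) (a x t : ℝ) : ℂ :=
  ((admConst α ψ ^ (-(1 / 2) : ℝ) : ℝ) : ℂ) * translation α x (dilation α a ψ) t

/-- The Hankel wavelet transform `W_ψ f (a, x) = ∫ f(t) conj(ψ_{a,x}(t)) dμ_α(t)`. -/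
def waveletTransform (α : ℝ) (ψ f : ℝ → ℂ) (z : ℝ × ℝ) : ℂ :=
  ∫ t, f t * (starRingEnd ℂ) (atom α ψ z.1 z.2 t) ∂(mu α)

/-- The integral `∫ g⁺ - ∫ g⁻` of a real function, with values in `[-∞, ∞]`. It is meaningful when
`g` is a.e. measurable and one of the two terms is finite; `∞ - ∞` is `⊥` by convention. -/
def extIntegral {X : Type*} [MeasurableSpace X] (m : Measure X) (g : X → ℝ) : EReal :=
  ((∫⁻ z, ENNReal.ofReal (g z) ∂m : ℝ≥0∞) : EReal) -
    ((∫⁻ z, ENNReal.ofReal (-g z) ∂m : ℝ≥0∞) : EReal)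

/-- The integrand `-ρ ln ρ` of the entropy (with `0 ln 0 = 0`), for `ρ = |W_ψ f|²`. -/
def entropyDensity (α : ℝ) (ψ f : ℝ → ℂ) (z : ℝ × ℝ) : ℝ :=
  -(‖waveletTransform α ψ f z‖ ^ 2 * Real.log (‖waveletTransform α ψ f z‖ ^ 2))

end

end HankelWavelet

/-!
The density `ρ = |W_ψ f|²` has two properties from which the inequality follows at once: it is
bounded by `M = ‖f‖² ‖ψ‖² / c_ψ`, and its total mass is `‖f‖²`
(`waveletTransform_energy_and_bound`). Indeed `-ρ ln ρ ≥ -ρ ln M` pointwise, and integrating gives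
the claim (`entropy_ge_of_le`).

Both properties come from Plancherel's theorem for the Hankel transform. If `F` is the transform of
`f`, then `W_ψ f(a, ·) = c_ψ^(-1/2) H(F · conj (H (D_a ψ)))`. The bound is then the Cauchy-Schwarz
inequality. For the mass, Plancherel's theorem evaluates the integral in `x`, and the definition of
`c_ψ` the one in `a`.

The Hankel analysis is built on the half-plane `{(p, q) : q > 0}` with the measure `dp q^(2α) dq`,
which polar coordinates identify with the product of `μ_α` and an angular probability measure
(`measurePreserving_polar`). There the translation by `x` averages `φ(|(p + x, q)|)` over the angle
of `(p, q)`; since the measure is invariant under translations and reflections in `p`, the Hankel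
translation is self-adjoint (`integral_translation_mul`) and contractive. Gaussian integrals over
the half-plane give the angular moments, hence Poisson's formula for `j_α`
(`besselj_eq_integral`), and the Hankel transforms of Gaussians.

Gaussians `e^(-s x²/2)` separate functions by Weierstrass' theorem
(`ae_eq_zero_of_forall_integral_gauss`). This is used twice. The Hankel transform preserves inner
products of Gaussians, so it extends to an isometry of `L²`, and testing against Gaussians shows
that the extension is given by the integral on `L¹ ∩ L²` (`exists_plancherel`). Testing against a
Gaussian in each variable gives the product formula `τ_x j_α(·ξ)(y) = j_α(xξ) j_α(yξ)`
(`translation_besselj`), that is, the Hankel transform turns translations into multiplications.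
-/

namespace HankelWavelet

open Set Real

/-! ### The half-plane model of the Hankel translation -/

/-- The constant `Γ(α+1) / (Γ(1/2) Γ(α+1/2))` normalizing the translation. -/
noncomputable def angularConst (α : ℝ) : ℝ :=
  Real.Gamma (α + 1) / (Real.Gamma (1 / 2) * Real.Gamma (α + 1 / 2))

/-- The angular measure `Γ(α+1) / (Γ(1/2) Γ(α+1/2)) (sin θ)^(2α) dθ` on `(0, π)`. -/
noncomputable def angular (α : ℝ) : Measure ℝ :=
  (volume.restrict (Ioo 0 π)).withDensity
    (fun θ => ENNReal.ofReal (angularConst α * sin θ ^ (2 * α)))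

/-- The measure `K q^(2α) dq` on `(0, ∞)`, where `K` is chosen so that polar coordinates map
`mu α × angular α` to the measure `dp × K q^(2α) dq` on the upper half-plane. -/
noncomputable def height (α : ℝ) : Measure ℝ :=
  (volume.restrict (Ioi 0)).withDensity
    (fun q => ENNReal.ofReal (angularConst α / (2 ^ α * Real.Gamma (α + 1)) * q ^ (2 * α)))

/-- The polar map `(y, θ) ↦ (y cos θ, y sin θ)`. -/
noncomputable def polar (p : ℝ × ℝ) : ℝ × ℝ := (p.1 * cos p.2, p.1 * sin p.2)

instance (α : ℝ) : SFinite (mu α) := by unfold mu; infer_instance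
instance (α : ℝ) : SFinite (angular α) := by unfold angular; infer_instance
instance (α : ℝ) : SFinite (height α) := by unfold height; infer_instance

lemma mu_eq_restrict_Ioi (α : ℝ) : mu α = (volume.restrict (Ioi (0 : ℝ))).withDensity
    (fun x => ENNReal.ofReal (x ^ (2 * α + 1) / (2 ^ α * Real.Gamma (α + 1)))) := by
  unfold mu
  rw [restrict_Ioi_eq_restrict_Ici]

lemma measurable_polar : Measurable polar := by
  unfold polar; fun_prop

lemma angularConst_pos {α : ℝ} (hα : -(1 / 2) < α) : 0 < angularConst α := by
  unfold angularConst
  have h1 := Real.Gamma_pos_of_pos (show 0 < α + 1 by linarith)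
  have h2 := Real.Gamma_pos_of_pos (show 0 < α + 1 / 2 by linarith)
  have h3 := Real.Gamma_pos_of_pos (show (0 : ℝ) < 1 / 2 by norm_num)
  positivity

theorem measurePreserving_polar {α : ℝ} (hα : -(1 / 2) < α) :
    MeasurePreserving polar ((mu α).prod (angular α)) (volume.prod (height α)) := by
  refine ⟨measurable_polar, Measure.ext_of_lintegral _ fun h hh => ?_⟩
  have hC := angularConst_pos hα
  have hG := Real.Gamma_pos_of_pos (show 0 < α + 1 by linarith)
  set D : ℝ := 2 ^ α * Real.Gamma (α + 1) with hD
  have hDpos : 0 < D := by positivity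
  rw [lintegral_map hh measurable_polar, mu_eq_restrict_Ioi, angular, height,
    prod_withDensity (by fun_prop) (by fun_prop), prod_withDensity_right (by fun_prop),
    Measure.prod_restrict,
    lintegral_withDensity_eq_lintegral_mul _ (by fun_prop)
      (show Measurable fun p => h (polar p) from hh.comp measurable_polar),
    lintegral_withDensity_eq_lintegral_mul _ (by fun_prop) hh, ← hD]
  have e1 : (volume : Measure ℝ).prod (volume.restrict (Ioi 0)) =
      (volume : Measure (ℝ × ℝ)).restrict (univ ×ˢ Ioi 0) := by
    rw [Measure.volume_eq_prod, ← Measure.prod_restrict, Measure.restrict_univ]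
  rw [e1, ← lintegral_indicator (MeasurableSet.univ.prod measurableSet_Ioi),
    ← lintegral_comp_polarCoord_symm, ← Measure.volume_eq_prod]
  have hsub : Ioi (0 : ℝ) ×ˢ Ioo 0 π ⊆ polarCoord.target := by
    rw [polarCoord_target]
    exact prod_mono le_rfl (Ioo_subset_Ioo_left (by linarith [pi_pos]))
  rw [← lintegral_indicator (measurableSet_Ioi.prod measurableSet_Ioo),
    ← lintegral_indicator polarCoord.open_target.measurableSet]
  refine lintegral_congr fun p => ?_
  by_cases hp : p ∈ Ioi (0 : ℝ) ×ˢ Ioo 0 π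
  · rw [indicator_of_mem hp, indicator_of_mem (hsub hp)]
    obtain ⟨h1, h2⟩ := hp
    have h1 : 0 < p.1 := h1
    have hs : 0 < sin p.2 := sin_pos_of_pos_of_lt_pi h2.1 h2.2
    rw [indicator_of_mem (by simp [mul_pos h1 hs])]
    simp only [Pi.mul_apply, polarCoord_symm_apply, smul_eq_mul]
    rw [← mul_assoc, ← ENNReal.ofReal_mul (by positivity), ← ENNReal.ofReal_mul (by positivity)]
    congr 2
    rw [mul_rpow h1.le hs.le, rpow_add h1, rpow_one]
    ring
  · rw [indicator_of_notMem hp]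
    by_cases hp' : p ∈ polarCoord.target
    · rw [indicator_of_mem hp', indicator_of_notMem, smul_zero]
      rw [polarCoord_target] at hp'
      obtain ⟨h1, h2⟩ := hp'
      have h1 : 0 < p.1 := h1
      have h3 : p.2 ≤ 0 := by
        by_contra h
        exact hp ⟨h1, not_le.1 h, h2.2⟩
      have hs : sin p.2 ≤ 0 := sin_nonpos_of_nonpos_of_neg_pi_le h3 h2.1.le
      simp only [polarCoord_symm_apply, mem_prod, mem_univ, mem_Ioi, true_and, not_lt]
      exact mul_nonpos_of_nonneg_of_nonpos h1.le hs
    · rw [indicator_of_notMem hp']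

/-! ### Moments of the angular measure -/

lemma integral_mu (α : ℝ) {E : Type*} [NormedAddCommGroup E] [NormedSpace ℝ E] (f : ℝ → E) :
    ∫ x, f x ∂(mu α) =
      ∫ x in Ioi 0, (x ^ (2 * α + 1) / (2 ^ α * Real.Gamma (α + 1))).toNNReal • f x := by
  rw [mu_eq_restrict_Ioi]
  exact integral_withDensity_eq_integral_smul (by fun_prop) f

lemma integral_height (α : ℝ) {E : Type*} [NormedAddCommGroup E] [NormedSpace ℝ E] (f : ℝ → E) :
    ∫ x, f x ∂(height α) = ∫ x in Ioi 0,
      (angularConst α / (2 ^ α * Real.Gamma (α + 1)) * x ^ (2 * α)).toNNReal • f x :=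
  integral_withDensity_eq_integral_smul (by fun_prop) f

lemma integral_angular (α : ℝ) {E : Type*} [NormedAddCommGroup E] [NormedSpace ℝ E] (f : ℝ → E) :
    ∫ x, f x ∂(angular α) =
      ∫ x in Ioo 0 π, (angularConst α * sin x ^ (2 * α)).toNNReal • f x :=
  integral_withDensity_eq_integral_smul (by fun_prop) f

lemma integral_polar {α : ℝ} (hα : -(1 / 2) < α) {E : Type*} [NormedAddCommGroup E]
    [NormedSpace ℝ E] {f : ℝ × ℝ → E} (hf : Continuous f) :
    ∫ p, f (polar p) ∂((mu α).prod (angular α)) = ∫ p, f p ∂(volume.prod (height α)) := by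
  rw [← (measurePreserving_polar hα).map_eq, integral_map measurable_polar.aemeasurable]
  exact hf.aestronglyMeasurable

lemma integral_mu_pow_mul_exp {α : ℝ} (hα : -(1 / 2) < α) (n : ℕ) :
    ∫ x, x ^ (2 * n) * exp (-x ^ 2) ∂(mu α) =
      Real.Gamma (n + α + 1) / 2 / (2 ^ α * Real.Gamma (α + 1)) := by
  have hG := Real.Gamma_pos_of_pos (show 0 < α + 1 by linarith)
  have key := integral_rpow_mul_exp_neg_mul_rpow (p := 2) (q := 2 * n + 2 * α + 1) (b := 1)
    (by norm_num) (by have : (0 : ℝ) ≤ n := n.cast_nonneg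
                      linarith) one_pos
  rw [integral_mu]
  have : ∀ x ∈ Ioi (0 : ℝ), (x ^ (2 * α + 1) / (2 ^ α * Real.Gamma (α + 1))).toNNReal •
      (x ^ (2 * n) * exp (-x ^ 2)) = (x ^ (2 * n + 2 * α + 1 : ℝ) * exp (-1 * x ^ (2 : ℝ))) *
        (2 ^ α * Real.Gamma (α + 1))⁻¹ := by
    intro x hx
    have hx : 0 < x := hx
    rw [NNReal.smul_def, Real.coe_toNNReal _ (by positivity), smul_eq_mul, rpow_two,
      show (2 * n + 2 * α + 1 : ℝ) = (2 * α + 1) + ((2 * n : ℕ) : ℝ) by push_cast; ring,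
      rpow_add hx (2 * α + 1), rpow_natCast]
    ring_nf
  rw [setIntegral_congr_fun measurableSet_Ioi this, integral_mul_const, key, one_rpow,
    show (2 * n + 2 * α + 1 + 1 : ℝ) / 2 = n + α + 1 by ring]
  ring

lemma integral_height_exp {α : ℝ} (hα : -(1 / 2) < α) :
    ∫ x, exp (-x ^ 2) ∂(height α) =
      angularConst α / (2 ^ α * Real.Gamma (α + 1)) * (Real.Gamma (α + 1 / 2) / 2) := by
  have hG := Real.Gamma_pos_of_pos (show 0 < α + 1 by linarith)
  have hC := angularConst_pos hα
  have key := integral_rpow_mul_exp_neg_mul_rpow (p := 2) (q := 2 * α) (b := 1)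
    (by norm_num) (by linarith) one_pos
  rw [integral_height]
  have : ∀ x ∈ Ioi (0 : ℝ),
      (angularConst α / (2 ^ α * Real.Gamma (α + 1)) * x ^ (2 * α)).toNNReal • exp (-x ^ 2) =
        angularConst α / (2 ^ α * Real.Gamma (α + 1)) *
          (x ^ (2 * α) * exp (-1 * x ^ (2 : ℝ))) := by
    intro x hx
    have hx : 0 < x := hx
    rw [NNReal.smul_def, Real.coe_toNNReal _ (by positivity), smul_eq_mul, rpow_two]
    ring_nf
  rw [setIntegral_congr_fun measurableSet_Ioi this, integral_const_mul, key, one_rpow,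
    show (2 * α + 1 : ℝ) / 2 = α + 1 / 2 by ring]
  ring

lemma integral_pow_mul_exp (n : ℕ) :
    ∫ x : ℝ, x ^ (2 * n) * exp (-x ^ 2) = Real.Gamma (n + 1 / 2) := by
  have key := integral_rpow_mul_exp_neg_mul_rpow (p := 2) (q := 2 * n) (b := 1)
    (by norm_num) (by have : (0 : ℝ) ≤ n := n.cast_nonneg
                      linarith) one_pos
  have h := integral_comp_abs (f := fun x : ℝ => x ^ (2 * n) * exp (-x ^ 2))
  have : ∀ x ∈ Ioi (0 : ℝ), x ^ (2 * n) * exp (-x ^ 2) =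
      x ^ (2 * n : ℝ) * exp (-1 * x ^ (2 : ℝ)) := by
    intro x hx
    rw [rpow_two, show (2 * n : ℝ) = ((2 * n : ℕ) : ℝ) by push_cast; ring, rpow_natCast]
    ring_nf
  rw [setIntegral_congr_fun measurableSet_Ioi this, key, one_rpow] at h
  simp only [pow_mul, sq_abs] at h ⊢
  rw [h, show (2 * n + 1 : ℝ) / 2 = n + 1 / 2 by ring]
  ring

/-- The even moments of the angular measure, obtained by integrating `p^(2n) e^(-p²-q²)` over the
half-plane in Cartesian and in polar coordinates. -/
lemma integral_angular_cos_pow {α : ℝ} (hα : -(1 / 2) < α) (n : ℕ) :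
    ∫ θ, cos θ ^ (2 * n) ∂(angular α) =
      Real.Gamma (α + 1) * Real.Gamma (n + 1 / 2) /
        (Real.Gamma (1 / 2) * Real.Gamma (n + α + 1)) := by
  have hG := Real.Gamma_pos_of_pos (show 0 < α + 1 by linarith)
  have hGn := Real.Gamma_pos_of_pos (show 0 < n + α + 1 by
    have : (0 : ℝ) ≤ n := n.cast_nonneg
    linarith)
  have hG2 := Real.Gamma_pos_of_pos (show 0 < α + 1 / 2 by linarith)
  have hG3 := Real.Gamma_pos_of_pos (show (0 : ℝ) < 1 / 2 by norm_num)
  have h := integral_polar hα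
    (f := fun p : ℝ × ℝ => (p.1 ^ (2 * n) * exp (-p.1 ^ 2)) * exp (-p.2 ^ 2)) (by fun_prop)
  rw [integral_prod_mul (fun x : ℝ => x ^ (2 * n) * exp (-x ^ 2)) (fun x : ℝ => exp (-x ^ 2)),
    integral_pow_mul_exp, integral_height_exp hα] at h
  have e : ∀ p : ℝ × ℝ, ((polar p).1 ^ (2 * n) * exp (-(polar p).1 ^ 2)) *
      exp (-(polar p).2 ^ 2) = (p.1 ^ (2 * n) * exp (-p.1 ^ 2)) * cos p.2 ^ (2 * n) := by
    intro p
    simp only [polar]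
    rw [mul_assoc, ← exp_add, show -(p.1 * cos p.2) ^ 2 + -(p.1 * sin p.2) ^ 2 =
      -p.1 ^ 2 * (sin p.2 ^ 2 + cos p.2 ^ 2) by ring, sin_sq_add_cos_sq]
    ring_nf
  simp_rw [e] at h
  rw [integral_prod_mul (fun x : ℝ => x ^ (2 * n) * exp (-x ^ 2))
    (fun x : ℝ => cos x ^ (2 * n)), integral_mu_pow_mul_exp hα] at h
  have h2 : (0 : ℝ) < 2 ^ α := by positivity
  rw [angularConst] at h
  generalize Real.Gamma (α + 1 / 2) = g at h hG2
  generalize Real.Gamma (1 / 2) = g' at h hG3 ⊢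
  field_simp at h ⊢
  linarith

theorem isProbabilityMeasure_angular {α : ℝ} (hα : -(1 / 2) < α) :
    IsProbabilityMeasure (angular α) := by
  have h := integral_angular_cos_pow hα 0
  have hG := Real.Gamma_pos_of_pos (show 0 < α + 1 by linarith)
  have hG3 := Real.Gamma_pos_of_pos (show (0 : ℝ) < 1 / 2 by norm_num)
  simp only [mul_zero, pow_zero, integral_const, smul_eq_mul, mul_one, CharP.cast_eq_zero,
    zero_add] at h
  rw [show Real.Gamma (α + 1) * Real.Gamma (1 / 2) /
    (Real.Gamma (1 / 2) * Real.Gamma (α + 1)) = 1 by field_simp, measureReal_def] at h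
  exact ⟨by rwa [← ENNReal.toReal_eq_one_iff]⟩

/-! ### The spherical Bessel function -/

/-- Poisson's integral representation, by integrating the cosine series term by term. -/
theorem besselj_eq_integral {α : ℝ} (hα : -(1 / 2) < α) (x : ℝ) :
    besselj α x = ∫ θ, cos (x * cos θ) ∂(angular α) := by
  have hprob := isProbabilityMeasure_angular hα
  have hG := Real.Gamma_pos_of_pos (show 0 < α + 1 by linarith)
  have hsum : HasSum (fun n : ℕ => ∫ θ, (-1) ^ n * (x * cos θ) ^ (2 * n) / ((2 * n).factorial : ℝ)
      ∂(angular α)) (∫ θ, cos (x * cos θ) ∂(angular α)) := by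
    refine hasSum_integral_of_dominated_convergence
      (fun n _ => x ^ (2 * n) / ((2 * n).factorial : ℝ)) (fun n => ?_) (fun n => ?_) ?_ ?_ ?_
    · exact Continuous.aestronglyMeasurable (by fun_prop)
    · refine ae_of_all _ fun θ => ?_
      rw [norm_div, norm_mul, norm_pow, norm_neg, norm_one, one_pow, one_mul, Real.norm_natCast,
        Real.norm_eq_abs, mul_pow, pow_mul (cos θ), abs_of_nonneg (by
          rw [pow_mul]; positivity)]
      gcongr
      have h1 : (cos θ ^ 2) ^ n ≤ 1 := pow_le_one₀ (sq_nonneg _) (cos_sq_le_one θ)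
      have h2 : 0 ≤ x ^ (2 * n) := by rw [pow_mul]; positivity
      nlinarith
    · exact ae_of_all _ fun θ => (Real.hasSum_cosh x).summable
    · exact integrable_const _
    · exact ae_of_all _ fun θ => Real.hasSum_cos _
  rw [besselj, ← hsum.tsum_eq, ← tsum_mul_left]
  refine tsum_congr fun n => ?_
  have hGn := Real.Gamma_pos_of_pos (show 0 < n + α + 1 by
    have : (0 : ℝ) ≤ n := n.cast_nonneg
    linarith)
  have e : ∀ θ, (-1) ^ n * (x * cos θ) ^ (2 * n) / ((2 * n).factorial : ℝ) =
      ((-1) ^ n * x ^ (2 * n) / ((2 * n).factorial : ℝ)) * cos θ ^ (2 * n) := fun θ => by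
    rw [mul_pow]; ring
  simp_rw [e]
  rw [integral_const_mul, integral_angular_cos_pow hα, Real.Gamma_nat_add_half,
    Real.Gamma_one_half_eq]
  have h3 : ((2 * n).factorial : ℝ) = (2 * n - 1).doubleFactorial * (2 ^ n * n.factorial) := by
    rcases n with _ | n
    · simp
    · have h := Nat.factorial_eq_mul_doubleFactorial (2 * n + 1)
      rw [show 2 * n + 1 + 1 = 2 * (n + 1) by ring, Nat.doubleFactorial_two_mul] at h
      rw [h, show 2 * (n + 1) - 1 = 2 * n + 1 by omega]
      push_cast
      ring
  have hd : (0 : ℝ) < (2 * n - 1).doubleFactorial := by exact_mod_cast Nat.doubleFactorial_pos _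
  have hn : (0 : ℝ) < n.factorial := by exact_mod_cast n.factorial_pos
  have hpi : 0 < √π := by positivity
  rw [h3, div_pow, pow_mul 2 2 n, show ((2 : ℝ) ^ 2) ^ n = 2 ^ n * 2 ^ n by
    rw [← mul_pow]; norm_num]
  field_simp

lemma abs_besselj_le_one {α : ℝ} (hα : -(1 / 2) < α) (x : ℝ) : |besselj α x| ≤ 1 := by
  have hprob := isProbabilityMeasure_angular hα
  rw [besselj_eq_integral hα, ← Real.norm_eq_abs]
  refine (norm_integral_le_of_norm_le_const (C := 1)
    (ae_of_all _ fun θ => ?_)).trans (by simp)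
  exact abs_cos_le_one _

lemma continuous_besselj {α : ℝ} (hα : -(1 / 2) < α) : Continuous (besselj α) := by
  have hprob := isProbabilityMeasure_angular hα
  rw [show besselj α = fun x => ∫ θ, cos (x * cos θ) ∂(angular α) from
    funext (besselj_eq_integral hα)]
  refine continuous_of_dominated (bound := fun _ => 1)
    (fun x => Continuous.aestronglyMeasurable (by fun_prop)) (fun x => ae_of_all _ fun θ => ?_)
    (integrable_const _) (ae_of_all _ fun θ => by fun_prop)
  exact abs_cos_le_one _

/-! ### Gaussian integrals -/

/-- The Gaussian `x ↦ exp(-s x² / 2)`. -/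
noncomputable def gauss (s x : ℝ) : ℝ := exp (-s * x ^ 2 / 2)

lemma continuous_gauss (s : ℝ) : Continuous (gauss s) := by unfold gauss; fun_prop

lemma gauss_pos (s x : ℝ) : 0 < gauss s x := exp_pos _

lemma gauss_le_one {s : ℝ} (hs : 0 ≤ s) (x : ℝ) : gauss s x ≤ 1 := by
  rw [gauss, exp_le_one_iff]
  nlinarith [mul_nonneg hs (sq_nonneg x)]

lemma gauss_mul_gauss (s t x : ℝ) : gauss s x * gauss t x = gauss (s + t) x := by
  rw [gauss, gauss, gauss, ← exp_add]
  ring_nf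

/-- No further constant appears, by the normalization of `μ_α`. -/
lemma integral_gauss {α : ℝ} (hα : -(1 / 2) < α) {s : ℝ} (hs : 0 < s) :
    ∫ x, gauss s x ∂(mu α) = s ^ (-(α + 1)) := by
  have hG := Real.Gamma_pos_of_pos (show 0 < α + 1 by linarith)
  have key := integral_rpow_mul_exp_neg_mul_rpow (p := 2) (q := 2 * α + 1) (b := s / 2)
    (by norm_num) (by linarith) (by positivity)
  rw [integral_mu]
  have : ∀ x ∈ Ioi (0 : ℝ), (x ^ (2 * α + 1) / (2 ^ α * Real.Gamma (α + 1))).toNNReal •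
      gauss s x = (x ^ (2 * α + 1 : ℝ) * exp (-(s / 2) * x ^ (2 : ℝ))) *
        (2 ^ α * Real.Gamma (α + 1))⁻¹ := by
    intro x hx
    have hx : 0 < x := hx
    rw [NNReal.smul_def, Real.coe_toNNReal _ (by positivity), smul_eq_mul, rpow_two, gauss,
      show -(s / 2) * x ^ 2 = -s * x ^ 2 / 2 by ring]
    ring
  rw [setIntegral_congr_fun measurableSet_Ioi this, integral_mul_const, key,
    show (2 * α + 1 + 1 : ℝ) / 2 = α + 1 by ring,
    show -(2 * α + 1 + 1 : ℝ) / 2 = -(α + 1) by ring, div_rpow hs.le (by norm_num),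
    rpow_neg (by norm_num : (0 : ℝ) ≤ 2), rpow_add (by norm_num : (0 : ℝ) < 2), rpow_one]
  field_simp

lemma integrable_gauss {α : ℝ} (hα : -(1 / 2) < α) {s : ℝ} (hs : 0 < s) :
    Integrable (gauss s) (mu α) := by
  by_contra h
  have := integral_gauss hα hs
  rw [integral_undef h] at this
  exact (rpow_pos_of_pos hs _).ne this

/-- In the half-plane this is `∫∫ e^(-s(p²+q²)/2) e^(zp)`, a product of one-dimensional Gaussian
integrals of which only the first depends on `z`; the value at `z = 0` fixes the constant. -/
theorem integral_gauss_mul_cexp {α : ℝ} (hα : -(1 / 2) < α) {s : ℝ} (hs : 0 < s) (z : ℂ) :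
    ∫ p : ℝ × ℝ, (gauss s p.1 : ℂ) * Complex.exp (z * (p.1 * cos p.2 : ℝ))
      ∂((mu α).prod (angular α)) = (s ^ (-(α + 1)) : ℝ) * Complex.exp (z ^ 2 / (2 * s)) := by
  have hprob := isProbabilityMeasure_angular hα
  have hsC : (s : ℂ) ≠ 0 := by exact_mod_cast hs.ne'
  have plane : ∀ z : ℂ, ∫ p : ℝ × ℝ, (gauss s p.1 : ℂ) * Complex.exp (z * (p.1 * cos p.2 : ℝ))
      ∂((mu α).prod (angular α)) = ((π / -(-(s : ℂ) / 2)) ^ (1 / 2 : ℂ) *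
        (∫ q, (gauss s q : ℂ) ∂(height α))) * Complex.exp (z ^ 2 / (2 * s)) := by
    intro z
    have h := integral_polar hα (f := fun p : ℝ × ℝ =>
      Complex.exp (-(s : ℂ) / 2 * p.1 ^ 2 + z * p.1 + 0) * (gauss s p.2 : ℂ)) (by
        have := continuous_gauss s
        fun_prop)
    rw [integral_prod_mul (fun x : ℝ => Complex.exp (-(s : ℂ) / 2 * x ^ 2 + z * x + 0))
      (fun x => (gauss s x : ℂ)), integral_cexp_quadratic (by
      simpa using (by linarith : -s / 2 < 0))] at h
    rw [mul_right_comm]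
    rw [show (0 : ℂ) - z ^ 2 / (4 * (-(s : ℂ) / 2)) = z ^ 2 / (2 * s) by field_simp; ring] at h
    rw [← h]
    refine integral_congr_ae (ae_of_all _ fun p => ?_)
    simp only [polar, gauss]
    push_cast
    rw [← Complex.exp_add, ← Complex.exp_add]
    congr 1
    have h1 := Complex.sin_sq_add_cos_sq (p.2 : ℂ)
    linear_combination (s : ℂ) * p.1 ^ 2 / 2 * h1
  have h0 := plane 0
  simp only [zero_mul, Complex.exp_zero, mul_one, ne_eq, OfNat.ofNat_ne_zero, not_false_eq_true,
    zero_pow, zero_div] at h0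
  rw [plane, ← h0, integral_fun_fst (fun x : ℝ => (gauss s x : ℂ)), probReal_univ, one_smul,
    integral_complex_ofReal, integral_gauss hα hs]

lemma integrable_gauss_mul_exp {α : ℝ} (hα : -(1 / 2) < α) {s : ℝ} (hs : 0 < s) (b : ℝ) :
    Integrable (fun p : ℝ × ℝ => gauss s p.1 * exp (b * (p.1 * cos p.2)))
      ((mu α).prod (angular α)) := by
  by_contra h
  have h1 := integral_gauss_mul_cexp hα hs (b : ℂ)
  have h2 : ∀ p : ℝ × ℝ, (gauss s p.1 : ℂ) * Complex.exp ((b : ℂ) * (p.1 * cos p.2 : ℝ)) =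
      ((gauss s p.1 * exp (b * (p.1 * cos p.2)) : ℝ) : ℂ) := fun p => by push_cast; rfl
  simp_rw [h2] at h1
  rw [integral_complex_ofReal, integral_undef h] at h1
  have h3 : ((s ^ (-(α + 1)) : ℝ) : ℂ) ≠ 0 := by
    exact_mod_cast (rpow_pos_of_pos hs _).ne'
  exact mul_ne_zero h3 (Complex.exp_ne_zero _) (h1.symm.trans Complex.ofReal_zero)

lemma integral_gauss_mul_exp {α : ℝ} (hα : -(1 / 2) < α) {s : ℝ} (hs : 0 < s) (b : ℝ) :
    ∫ x, gauss s x * ∫ θ, exp (b * (x * cos θ)) ∂(angular α) ∂(mu α) =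
      s ^ (-(α + 1)) * exp (b ^ 2 / (2 * s)) := by
  have h1 := integral_gauss_mul_cexp hα hs (b : ℂ)
  have h2 : ∀ p : ℝ × ℝ, (gauss s p.1 : ℂ) * Complex.exp ((b : ℂ) * (p.1 * cos p.2 : ℝ)) =
      ((gauss s p.1 * exp (b * (p.1 * cos p.2)) : ℝ) : ℂ) := fun p => by push_cast; rfl
  simp_rw [h2] at h1
  rw [integral_complex_ofReal, integral_prod _ (integrable_gauss_mul_exp hα hs b)] at h1
  simp_rw [← integral_const_mul]
  exact_mod_cast h1

lemma integral_gauss_mul_besselj {α : ℝ} (hα : -(1 / 2) < α) {s : ℝ} (hs : 0 < s) (ξ : ℝ) :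
    ∫ x, gauss s x * besselj α (x * ξ) ∂(mu α) = s ^ (-(α + 1)) * gauss s⁻¹ ξ := by
  have hprob := isProbabilityMeasure_angular hα
  have h1 := integral_gauss_mul_cexp hα hs (ξ * Complex.I)
  have hint : Integrable (fun p : ℝ × ℝ => (gauss s p.1 : ℂ) *
      Complex.exp (ξ * Complex.I * (p.1 * cos p.2 : ℝ))) ((mu α).prod (angular α)) := by
    by_contra h
    rw [integral_undef h] at h1
    have h3 : ((s ^ (-(α + 1)) : ℝ) : ℂ) ≠ 0 := by
      exact_mod_cast (rpow_pos_of_pos hs _).ne'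
    exact mul_ne_zero h3 (Complex.exp_ne_zero _) h1.symm
  have e1 : ∀ p : ℝ × ℝ, RCLike.re ((gauss s p.1 : ℂ) *
      Complex.exp (ξ * Complex.I * (p.1 * cos p.2 : ℝ))) =
      gauss s p.1 * cos (p.1 * ξ * cos p.2) := fun p => by
    rw [show (ξ : ℂ) * Complex.I * (p.1 * cos p.2 : ℝ) = (p.1 * ξ * cos p.2 : ℝ) * Complex.I by
      push_cast; ring]
    change (_ : ℂ).re = _
    rw [Complex.re_ofReal_mul, Complex.exp_ofReal_mul_I_re]
  have e2 := integral_re hint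
  have hint2 := hint.re
  simp_rw [e1] at e2 hint2
  rw [integral_prod _ hint2] at e2
  simp_rw [integral_const_mul, ← besselj_eq_integral hα] at e2
  rw [e2, h1, show ((ξ : ℂ) * Complex.I) ^ 2 / (2 * s) = ((-s⁻¹ * ξ ^ 2 / 2 : ℝ) : ℂ) by
    rw [mul_pow, Complex.I_sq]
    push_cast
    ring, ← Complex.ofReal_exp, ← Complex.ofReal_mul]
  rfl

/-! ### The Hankel translation through the half-plane -/

/-- The distance `√(x² + y² + 2xy cos θ)` at which the translation evaluates a function. -/
noncomputable def shiftRadius (x : ℝ) (p : ℝ × ℝ) : ℝ :=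
  √(x ^ 2 + p.1 ^ 2 + 2 * x * p.1 * cos p.2)

/-- The Euclidean norm on `ℝ²`. -/
noncomputable def radius (p : ℝ × ℝ) : ℝ := √(p.1 ^ 2 + p.2 ^ 2)

/-- The reflection of the half-plane exchanging `0` and `(-x, 0)`. -/
def reflect (x : ℝ) (p : ℝ × ℝ) : ℝ × ℝ := (-x - p.1, p.2)

lemma reflect_reflect (x : ℝ) (p : ℝ × ℝ) : reflect x (reflect x p) = p := by
  simp [reflect]

lemma shiftRadius_eq (x : ℝ) (p : ℝ × ℝ) : shiftRadius x p = radius (reflect x (polar p)) := by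
  simp only [shiftRadius, radius, reflect, polar]
  congr 1
  linear_combination -p.1 ^ 2 * (sin_sq_add_cos_sq p.2)

lemma radius_polar {p : ℝ × ℝ} (hp : 0 ≤ p.1) : radius (polar p) = p.1 := by
  simp only [radius, polar]
  rw [show (p.1 * cos p.2) ^ 2 + (p.1 * sin p.2) ^ 2 = p.1 ^ 2 by
    linear_combination p.1 ^ 2 * (sin_sq_add_cos_sq p.2), sqrt_sq hp]

lemma continuous_shiftRadius (x : ℝ) : Continuous (shiftRadius x) := by
  unfold shiftRadius; fun_prop

lemma continuous_radius : Continuous radius := by unfold radius; fun_prop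

lemma ae_mu_pos (α : ℝ) : ∀ᵐ x ∂(mu α), 0 < x := by
  rw [mu_eq_restrict_Ioi]
  exact (withDensity_absolutelyContinuous _ _).ae_le (ae_restrict_mem measurableSet_Ioi)

lemma measurePreserving_fst_mu {α : ℝ} (hα : -(1 / 2) < α) :
    MeasurePreserving Prod.fst ((mu α).prod (angular α)) (mu α) := by
  have hprob := isProbabilityMeasure_angular hα
  exact measurePreserving_fst

lemma radius_polar_ae {α : ℝ} (hα : -(1 / 2) < α) :
    (fun p => radius (polar p)) =ᵐ[(mu α).prod (angular α)] Prod.fst := by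
  filter_upwards [(measurePreserving_fst_mu hα).quasiMeasurePreserving.ae (ae_mu_pos α)] with p hp
  exact radius_polar hp.le

lemma measurePreserving_radius {α : ℝ} (hα : -(1 / 2) < α) :
    MeasurePreserving radius (volume.prod (height α)) (mu α) := by
  refine ⟨continuous_radius.measurable, ?_⟩
  rw [← (measurePreserving_polar hα).map_eq,
    Measure.map_map continuous_radius.measurable measurable_polar,
    show radius ∘ polar = fun p => radius (polar p) from rfl, Measure.map_congr (radius_polar_ae hα),
    (measurePreserving_fst_mu hα).map_eq]

lemma measurePreserving_reflect (α x : ℝ) :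
    MeasurePreserving (reflect x) (volume.prod (height α)) (volume.prod (height α)) :=
  (Measure.measurePreserving_sub_left volume (-x)).prod (MeasurePreserving.id (height α))

theorem measurePreserving_shiftRadius {α : ℝ} (hα : -(1 / 2) < α) (x : ℝ) :
    MeasurePreserving (shiftRadius x) ((mu α).prod (angular α)) (mu α) := by
  rw [show shiftRadius x = radius ∘ reflect x ∘ polar from funext (shiftRadius_eq x)]
  exact (measurePreserving_radius hα).comp
    ((measurePreserving_reflect α x).comp (measurePreserving_polar hα))

lemma translation_eq_integral {α : ℝ} (hα : -(1 / 2) < α) (x : ℝ) (f : ℝ → ℂ) (y : ℝ) :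
    translation α x f y = ∫ θ, f (shiftRadius x (y, θ)) ∂(angular α) := by
  have hC := angularConst_pos hα
  rw [translation, integral_angular, intervalIntegral.integral_of_le pi_pos.le,
    integral_Ioc_eq_integral_Ioo, ← integral_const_mul]
  refine setIntegral_congr_fun measurableSet_Ioo fun θ hθ => ?_
  have hs := sin_pos_of_pos_of_lt_pi hθ.1 hθ.2
  simp only [shiftRadius]
  rw [NNReal.smul_def, Real.coe_toNNReal _ (by positivity), Complex.real_smul, angularConst]
  push_cast
  ring

/-- In the half-plane both sides are `∫ φ(|p + x e₁|) h(|p|)`, up to the reflection exchanging `0`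
and `-x e₁`. -/
theorem integral_comp_shiftRadius_mul {α : ℝ} (hα : -(1 / 2) < α) (x : ℝ) {φ h : ℝ → ℂ}
    (hφ : AEStronglyMeasurable φ (mu α)) (hh : AEStronglyMeasurable h (mu α)) :
    ∫ p, φ (shiftRadius x p) * h p.1 ∂((mu α).prod (angular α)) =
      ∫ p, φ p.1 * h (shiftRadius x p) ∂((mu α).prod (angular α)) := by
  have hr := (measurePreserving_radius hα)
  have hm := measurePreserving_reflect α x
  have toPlane : ∀ {u v : ℝ → ℂ}, AEStronglyMeasurable u (mu α) → AEStronglyMeasurable v (mu α) →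
      ∫ p, u (shiftRadius x p) * v p.1 ∂((mu α).prod (angular α)) =
        ∫ q, u (radius (reflect x q)) * v (radius q) ∂(volume.prod (height α)) := by
    intro u v hu hv
    rw [← (measurePreserving_polar hα).map_eq, integral_map measurable_polar.aemeasurable]
    · refine integral_congr_ae ?_
      filter_upwards [radius_polar_ae hα] with p hp
      rw [hp, shiftRadius_eq]
    · rw [(measurePreserving_polar hα).map_eq]
      exact (hu.comp_quasiMeasurePreserving (hr.comp hm).quasiMeasurePreserving).mul
        (hv.comp_quasiMeasurePreserving hr.quasiMeasurePreserving)
  rw [toPlane hφ hh]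
  simp_rw [mul_comm (φ _)]
  rw [toPlane hh hφ]
  conv_rhs => rw [← hm.map_eq]
  rw [integral_map hm.measurable.aemeasurable]
  · simp_rw [reflect_reflect]
  · rw [hm.map_eq]
    exact (hh.comp_quasiMeasurePreserving (hr.comp hm).quasiMeasurePreserving).mul
        (hφ.comp_quasiMeasurePreserving hr.quasiMeasurePreserving)

/-- The translation is self-adjoint. -/
theorem integral_translation_mul {α : ℝ} (hα : -(1 / 2) < α) (x : ℝ) {φ h : ℝ → ℂ}
    (hφ : Integrable φ (mu α)) (hh : Continuous h) {C : ℝ} (hC : ∀ y, ‖h y‖ ≤ C) :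
    ∫ y, translation α x φ y * h y ∂(mu α) = ∫ y, φ y * translation α x h y ∂(mu α) := by
  have hprob := isProbabilityMeasure_angular hα
  have hR := measurePreserving_shiftRadius hα x
  have hF := measurePreserving_fst_mu hα
  have e := integral_comp_shiftRadius_mul hα x hφ.1 hh.aestronglyMeasurable
  rw [integral_prod, integral_prod] at e
  · simp_rw [translation_eq_integral hα]
    simp_rw [integral_mul_const, integral_const_mul] at e
    exact e
  · exact (hF.integrable_comp_of_integrable hφ).mul_bdd (c := C)
      (hh.comp (continuous_shiftRadius x)).aestronglyMeasurable (ae_of_all _ fun p => hC _)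
  · exact (hR.integrable_comp_of_integrable hφ).mul_bdd (c := C)
      (hh.comp continuous_fst).aestronglyMeasurable (ae_of_all _ fun p => hC _)

lemma integrable_translation {α : ℝ} (hα : -(1 / 2) < α) (x : ℝ) {φ : ℝ → ℂ}
    (hφ : Integrable φ (mu α)) : Integrable (translation α x φ) (mu α) := by
  rw [show translation α x φ = _ from funext (translation_eq_integral hα x φ)]
  exact ((measurePreserving_shiftRadius hα x).integrable_comp_of_integrable hφ).integral_prod_left

/-- The translation is an average of compositions with measure preserving maps, hence bounded on
`L²` by Jensen's inequality. -/
lemma memLp_two_translation {α : ℝ} (hα : -(1 / 2) < α) (x : ℝ) {φ : ℝ → ℂ}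
    (hφ1 : Integrable φ (mu α)) (hφ : MemLp φ 2 (mu α)) :
    MemLp (translation α x φ) 2 (mu α) := by
  have hprob := isProbabilityMeasure_angular hα
  have hR := measurePreserving_shiftRadius hα x
  have h1 := integrable_translation hα x hφ1
  have h2 : Integrable (fun p => ‖φ (shiftRadius x p)‖ ^ 2) ((mu α).prod (angular α)) :=
    (hφ.comp_measurePreserving hR).integrable_norm_pow (by norm_num)
  rw [memLp_two_iff_integrable_sq_norm h1.1]
  refine h2.integral_prod_left.mono' (h1.1.norm.pow 2) ?_
  filter_upwards [h2.prod_right_ae, (hR.integrable_comp_of_integrable hφ1).prod_right_ae]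
    with y hy1 hy2
  rw [Real.norm_of_nonneg (by positivity), translation_eq_integral hα]
  calc ‖∫ θ, φ (shiftRadius x (y, θ)) ∂(angular α)‖ ^ 2
      ≤ (∫ θ, ‖φ (shiftRadius x (y, θ))‖ ∂(angular α)) ^ 2 := by
        gcongr
        exact norm_integral_le_integral_norm _
    _ ≤ ∫ θ, ‖φ (shiftRadius x (y, θ))‖ ^ 2 ∂(angular α) :=
        (even_two.convexOn_pow (𝕜 := ℝ)).map_integral_le (continuous_pow 2).continuousOn
          isClosed_univ (ae_of_all _ fun _ => mem_univ _) hy2.norm hy1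

-- partially applied translations would otherwise be unfolded during unification
attribute [local irreducible] translation

/-! ### Gaussians separate functions -/

lemma gauss_natCast_add_one (m : ℕ) (x : ℝ) : gauss (m + 1) x = gauss 1 x ^ m * gauss 1 x := by
  rw [← pow_succ, gauss, gauss, ← exp_nat_mul]
  push_cast
  ring_nf

/-- The Gaussians `gauss n = (gauss 1)^n` span the polynomials without constant term in `gauss 1`;
by Weierstrass' theorem, integration against them determines a function. -/
theorem ae_eq_zero_of_forall_integral_gauss {α : ℝ} {h : ℝ → ℂ}
    (hint : Integrable (fun x => (gauss 1 x : ℂ) * h x) (mu α))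
    (h0 : ∀ s : ℝ, 0 < s → ∫ x, (gauss s x : ℂ) * h x ∂(mu α) = 0) : h =ᵐ[mu α] 0 := by
  set k : ℝ → ℂ := fun x => (gauss 1 x : ℂ) * h x with hk
  have hu : ∀ x, gauss 1 x ∈ Icc (0 : ℝ) 1 := fun x =>
    ⟨(gauss_pos 1 x).le, gauss_le_one zero_le_one x⟩
  have hcont := continuous_gauss 1
  have hmul : ∀ {G : ℝ → ℝ}, Continuous G →
      Integrable (fun x => (G (gauss 1 x) : ℂ) * k x) (mu α) := by
    intro G hG
    obtain ⟨C, hC⟩ := isCompact_Icc.exists_bound_of_continuousOn (s := Icc (0 : ℝ) 1)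
      hG.continuousOn
    refine hint.bdd_mul (c := C) (Continuous.aestronglyMeasurable (by fun_prop))
      (ae_of_all _ fun x => ?_)
    rw [Complex.norm_real]
    exact hC _ (hu x)
  have hpoly : ∀ p : Polynomial ℝ, ∫ x, ((p.eval (gauss 1 x) : ℝ) : ℂ) * k x ∂(mu α) = 0 := by
    intro p
    induction p using Polynomial.induction_on' with
    | add p q hp hq =>
      simp_rw [Polynomial.eval_add, Complex.ofReal_add, add_mul]
      rw [integral_add (hmul p.continuous) (hmul q.continuous), hp, hq, add_zero]
    | monomial n a =>
      have := h0 (n + 1) (by positivity)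
      simp_rw [gauss_natCast_add_one, Complex.ofReal_mul, mul_assoc] at this
      simp_rw [Polynomial.eval_monomial, Complex.ofReal_mul, mul_assoc]
      rw [integral_const_mul, this, mul_zero]
  have hall : ∀ {G : ℝ → ℝ}, Continuous G → ∫ x, (G (gauss 1 x) : ℂ) * k x ∂(mu α) = 0 := by
    intro G hG
    have hle : ∀ ε > 0, ‖∫ x, (G (gauss 1 x) : ℂ) * k x ∂(mu α)‖ ≤ ε * ∫ x, ‖k x‖ ∂(mu α) := by
      intro ε hε
      obtain ⟨p, hp⟩ := exists_polynomial_near_of_continuousOn 0 1 G hG.continuousOn ε hε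
      have e : ∫ x, (G (gauss 1 x) : ℂ) * k x ∂(mu α) =
          ∫ x, ((G (gauss 1 x) - p.eval (gauss 1 x) : ℝ) : ℂ) * k x ∂(mu α) := by
        simp_rw [Complex.ofReal_sub, sub_mul]
        rw [integral_sub (hmul hG) (hmul p.continuous), hpoly, sub_zero]
      rw [e, ← integral_const_mul]
      refine norm_integral_le_of_norm_le (hint.norm.const_mul ε) (ae_of_all _ fun x => ?_)
      rw [norm_mul, Complex.norm_real, Real.norm_eq_abs, abs_sub_comm]
      gcongr
      exact (hp _ (hu x)).le
    have hI : 0 ≤ ∫ x, ‖k x‖ ∂(mu α) := integral_nonneg fun _ => norm_nonneg _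
    rw [← norm_le_zero_iff]
    refine le_of_forall_pos_le_add fun δ hδ => ?_
    rw [zero_add]
    refine (hle (δ / (∫ x, ‖k x‖ ∂(mu α) + 1)) (by positivity)).trans ?_
    rw [div_mul_eq_mul_div, div_le_iff₀ (by positivity)]
    nlinarith
  have hk0 : ∀ᵐ x ∂(mu α), k x = 0 := by
    refine ae_eq_zero_of_integral_contDiff_smul_eq_zero hint.locallyIntegrable fun g hg hgs => ?_
    obtain ⟨R, hR0, hR⟩ : ∃ R : ℝ, 0 ≤ R ∧ ∀ x, R ≤ x → g x = 0 := by
      obtain ⟨R, hR⟩ := hgs.isCompact.isBounded.subset_closedBall 0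
      refine ⟨|R| + 1, by positivity, fun x hx => ?_⟩
      by_contra hne
      have := hR (subset_tsupport g hne)
      rw [mem_closedBall_zero_iff, Real.norm_eq_abs] at this
      linarith [le_abs_self x, le_abs_self R]
    -- on `[0, ∞)`, `g` is a continuous function of `gauss 1`; the maximum cuts off the values
    -- coming from `x > R`, where `g` vanishes
    have hG : Continuous fun u : ℝ => g (√(-2 * log (max u (gauss 1 R)))) := by
      have hm : Continuous fun u : ℝ => log (max u (gauss 1 R)) :=
        Continuous.log (by fun_prop) fun u => (lt_max_of_lt_right (gauss_pos 1 R)).ne'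
      exact hg.continuous.comp (by fun_prop)
    rw [← hall hG]
    refine integral_congr_ae ?_
    filter_upwards [ae_mu_pos α] with x hx
    rw [Complex.real_smul]
    congr 2
    rcases le_total x R with hxR | hxR
    · have : gauss 1 R ≤ gauss 1 x := by
        rw [gauss, gauss, exp_le_exp]
        nlinarith
      rw [max_eq_left this, gauss, log_exp, show -2 * (-1 * x ^ 2 / 2) = x ^ 2 by ring,
        sqrt_sq hx.le]
    · have : gauss 1 x ≤ gauss 1 R := by
        rw [gauss, gauss, exp_le_exp]
        nlinarith
      rw [max_eq_right this, gauss, log_exp, show -2 * (-1 * R ^ 2 / 2) = R ^ 2 by ring,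
        sqrt_sq hR0, hR x hxR, hR R le_rfl]
  filter_upwards [hk0] with x hx
  have : (gauss 1 x : ℂ) ≠ 0 := by exact_mod_cast (gauss_pos 1 x).ne'
  exact (mul_eq_zero.1 hx).resolve_left this

lemma eq_zero_of_ae_mu {α : ℝ} (hα : -(1 / 2) < α) {h : ℝ → ℂ} (hc : Continuous h)
    (h0 : h =ᵐ[mu α] 0) {x : ℝ} (hx : 0 < x) : h x = 0 := by
  have hG := Real.Gamma_pos_of_pos (show 0 < α + 1 by linarith)
  have h1 : ∀ᵐ x ∂(volume.restrict (Ioi (0 : ℝ))), h x = 0 := by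
    rw [mu_eq_restrict_Ioi, Filter.EventuallyEq, ae_withDensity_iff (by fun_prop)] at h0
    filter_upwards [h0, ae_restrict_mem measurableSet_Ioi] with y hy hy0
    have hy0 : 0 < y := hy0
    exact hy (by rw [ne_eq, ENNReal.ofReal_eq_zero, not_le]; positivity)
  exact (Measure.eqOn_open_of_ae_eq (g := fun _ => (0 : ℂ)) h1 isOpen_Ioi hc.continuousOn
    continuousOn_const) hx

/-! ### The product formula -/

lemma translation_gauss {α : ℝ} (hα : -(1 / 2) < α) (t x y : ℝ) :
    translation α x (fun y => (gauss t y : ℂ)) y =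
      ((gauss t x * gauss t y * ∫ θ, exp (-(t * y) * (x * cos θ)) ∂(angular α) : ℝ) : ℂ) := by
  rw [translation_eq_integral hα, ← integral_const_mul, ← integral_complex_ofReal]
  refine integral_congr_ae (ae_of_all _ fun θ => ?_)
  simp only [Complex.ofReal_inj, shiftRadius, gauss]
  rw [← exp_add, ← exp_add, sq_sqrt]
  · ring_nf
  · nlinarith [sin_sq_add_cos_sq θ, sq_nonneg (x + y * cos θ), sq_nonneg (y * sin θ)]

/-- The convolution of two Gaussians is a Gaussian. -/
lemma integral_gauss_mul_translation_gauss {α : ℝ} (hα : -(1 / 2) < α) {s t : ℝ} (hs : 0 < s)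
    (ht : 0 < t) (y : ℝ) :
    ∫ x, (gauss s x : ℂ) * translation α x (fun y => (gauss t y : ℂ)) y ∂(mu α) =
      (((s + t) ^ (-(α + 1)) * gauss (s * t / (s + t)) y : ℝ) : ℂ) := by
  have h := integral_gauss_mul_exp hα (add_pos hs ht) (-(t * y))
  simp_rw [translation_gauss hα, ← Complex.ofReal_mul]
  rw [integral_complex_ofReal]
  congr 1
  have e : ∀ x, gauss s x * (gauss t x * gauss t y * ∫ θ, exp (-(t * y) * (x * cos θ))
      ∂(angular α)) = gauss t y * (gauss (s + t) x *
        ∫ θ, exp (-(t * y) * (x * cos θ)) ∂(angular α)) := fun x => by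
    rw [← gauss_mul_gauss]; ring
  simp_rw [e]
  rw [integral_const_mul, h, mul_left_comm, gauss, gauss, ← exp_add]
  congr 2
  have : s + t ≠ 0 := (add_pos hs ht).ne'
  field_simp
  ring

lemma norm_besselj_le_one {α : ℝ} (hα : -(1 / 2) < α) (x : ℝ) : ‖(besselj α x : ℂ)‖ ≤ 1 := by
  rw [Complex.norm_real]
  exact abs_besselj_le_one hα x

lemma norm_translation_le {α : ℝ} (hα : -(1 / 2) < α) {h : ℝ → ℂ} {C : ℝ} (hC : ∀ y, ‖h y‖ ≤ C)
    (x y : ℝ) : ‖translation α x h y‖ ≤ C := by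
  have hprob := isProbabilityMeasure_angular hα
  rw [translation_eq_integral hα]
  exact (norm_integral_le_of_norm_le_const (ae_of_all _ fun θ => hC _)).trans (by simp)

lemma continuous_translation {α : ℝ} (hα : -(1 / 2) < α) {h : ℝ → ℂ} (hc : Continuous h) {C : ℝ}
    (hC : ∀ y, ‖h y‖ ≤ C) {X : Type*} [TopologicalSpace X] [FirstCountableTopology X] {a b : X → ℝ}
    (ha : Continuous a) (hb : Continuous b) : Continuous fun p => translation α (a p) h (b p) := by
  have hprob := isProbabilityMeasure_angular hα
  simp_rw [translation_eq_integral hα]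
  refine continuous_of_dominated (bound := fun _ => C) (fun p => ?_)
    (fun p => ae_of_all _ fun θ => hC _) (integrable_const _) (ae_of_all _ fun θ => ?_)
  · exact (hc.comp ((continuous_shiftRadius _).comp (by fun_prop))).aestronglyMeasurable
  · unfold shiftRadius
    exact hc.comp (by fun_prop)

lemma integrable_ofReal_gauss {α : ℝ} (hα : -(1 / 2) < α) {s : ℝ} (hs : 0 < s) :
    Integrable (fun x => (gauss s x : ℂ)) (mu α) := (integrable_gauss hα hs).ofReal

lemma integrable_gauss_mul {α : ℝ} (hα : -(1 / 2) < α) {s : ℝ} (hs : 0 < s) {h : ℝ → ℂ}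
    (hm : AEStronglyMeasurable h (mu α)) {C : ℝ} (hC : ∀ y, ‖h y‖ ≤ C) :
    Integrable (fun x => (gauss s x : ℂ) * h x) (mu α) :=
  (integrable_ofReal_gauss hα hs).mul_bdd (c := C) hm (ae_of_all _ hC)

lemma integral_norm_translation_le {α : ℝ} (hα : -(1 / 2) < α) (x : ℝ) {φ : ℝ → ℂ}
    (hφ : Integrable φ (mu α)) :
    ∫ y, ‖translation α x φ y‖ ∂(mu α) ≤ ∫ y, ‖φ y‖ ∂(mu α) := by
  have hprob := isProbabilityMeasure_angular hα
  have hR := measurePreserving_shiftRadius hα x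
  have h1 := hR.integrable_comp_of_integrable hφ
  have e : ∫ y, ‖φ y‖ ∂(mu α) =
      ∫ y, ∫ θ, ‖φ (shiftRadius x (y, θ))‖ ∂(angular α) ∂(mu α) := by
    rw [← integral_prod (fun p => ‖φ (shiftRadius x p)‖) h1.norm]
    conv_lhs => rw [← hR.map_eq]
    rw [integral_map hR.measurable.aemeasurable]
    rw [hR.map_eq]
    exact hφ.1.norm
  rw [e]
  refine integral_mono (integrable_translation hα x hφ).norm h1.norm.integral_prod_left fun y => ?_
  simp only [translation_eq_integral hα]
  exact norm_integral_le_integral_norm _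

lemma continuous_ofReal_gauss (t : ℝ) : Continuous fun y => (gauss t y : ℂ) := by
  have := continuous_gauss t
  fun_prop

lemma norm_gauss_le_one {t : ℝ} (ht : 0 ≤ t) (y : ℝ) : ‖(gauss t y : ℂ)‖ ≤ 1 := by
  rw [Complex.norm_real, Real.norm_of_nonneg (gauss_pos t y).le]
  exact gauss_le_one ht y

lemma integrable_gauss_mul_translation_gauss {α : ℝ} (hα : -(1 / 2) < α) {s t : ℝ} (hs : 0 < s)
    (ht : 0 < t) : Integrable (fun p : ℝ × ℝ => (gauss s p.1 : ℂ) *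
      translation α p.1 (fun y => (gauss t y : ℂ)) p.2) ((mu α).prod (mu α)) := by
  have hT := continuous_translation hα (continuous_ofReal_gauss t) (norm_gauss_le_one ht.le)
    continuous_fst continuous_snd (X := ℝ × ℝ)
  have hg := integrable_ofReal_gauss hα ht
  have hs' := continuous_ofReal_gauss s
  have hm : Continuous (fun p : ℝ × ℝ => (gauss s p.1 : ℂ) *
      translation α p.1 (fun y => (gauss t y : ℂ)) p.2) := (hs'.comp continuous_fst).mul hT
  rw [integrable_prod_iff hm.aestronglyMeasurable]
  refine ⟨ae_of_all _ fun x => ?_, ?_⟩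
  · exact (integrable_translation hα x hg).const_mul (gauss s x : ℂ)
  simp_rw [norm_mul, integral_const_mul]
  have hgs := (integrable_ofReal_gauss hα hs).norm
  refine hgs.mul_bdd (c := ∫ y, ‖(gauss t y : ℂ)‖ ∂(mu α)) ?_ (ae_of_all _ fun x => ?_)
  · exact (StronglyMeasurable.integral_prod_right
      (f := fun x y => ‖translation α x (fun y => (gauss t y : ℂ)) y‖)
      hT.norm.stronglyMeasurable).aestronglyMeasurable
  · rw [Real.norm_of_nonneg (integral_nonneg fun _ => norm_nonneg _)]
    exact integral_norm_translation_le hα x hg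

/-- By self-adjointness and Fubini's theorem, the left-hand side is the integral of `j` against the
convolution of the two Gaussians. -/
lemma integral_gauss_mul_integral_gauss_mul_translation {α : ℝ} (hα : -(1 / 2) < α) {s t : ℝ}
    (hs : 0 < s) (ht : 0 < t) {j : ℝ → ℂ} (hj : Continuous j) (hj1 : ∀ y, ‖j y‖ ≤ 1) :
    ∫ x, (gauss s x : ℂ) * ∫ y, (gauss t y : ℂ) * translation α x j y ∂(mu α) ∂(mu α) =
      (((s + t) ^ (-(α + 1)) : ℝ) : ℂ) *
        ∫ y, (gauss (s * t / (s + t)) y : ℂ) * j y ∂(mu α) := by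
  have hg := integrable_ofReal_gauss hα ht
  have e := fun x => integral_translation_mul hα x hg hj hj1
  simp_rw [← e, ← integral_const_mul, ← mul_assoc]
  rw [integral_integral_swap]
  · simp_rw [integral_mul_const, integral_gauss_mul_translation_gauss hα hs ht]
    simp
  · exact (integrable_gauss_mul_translation_gauss hα hs ht).mul_bdd (c := 1)
      (hj.comp continuous_snd).aestronglyMeasurable (ae_of_all _ fun p => hj1 _)

lemma continuous_integral_gauss_mul_translation {α : ℝ} (hα : -(1 / 2) < α) {t : ℝ} (ht : 0 < t)
    {j : ℝ → ℂ} (hjc : Continuous j) (hj1 : ∀ y, ‖j y‖ ≤ 1) :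
    Continuous fun x => ∫ y, (gauss t y : ℂ) * translation α x j y ∂(mu α) := by
  have hg := integrable_ofReal_gauss hα ht
  have hgc := continuous_ofReal_gauss t
  refine continuous_of_dominated (bound := fun y => ‖(gauss t y : ℂ)‖) (fun x => ?_)
    (fun x => ae_of_all _ fun y => ?_) hg.norm (ae_of_all _ fun y => ?_)
  · have := continuous_translation hα hjc hj1 (continuous_const (y := x)) continuous_id'
    exact Continuous.aestronglyMeasurable (by fun_prop)
  · rw [norm_mul]
    exact mul_le_of_le_one_right (norm_nonneg _) (norm_translation_le hα hj1 x y)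
  · have := continuous_translation hα hjc hj1 continuous_id' (continuous_const (y := y))
    fun_prop

lemma norm_integral_gauss_mul_translation_le {α : ℝ} (hα : -(1 / 2) < α) {t : ℝ} (ht : 0 < t)
    {j : ℝ → ℂ} (hj1 : ∀ y, ‖j y‖ ≤ 1) (x : ℝ) :
    ‖∫ y, (gauss t y : ℂ) * translation α x j y ∂(mu α)‖ ≤ ∫ y, ‖(gauss t y : ℂ)‖ ∂(mu α) := by
  refine norm_integral_le_of_norm_le (integrable_ofReal_gauss hα ht).norm
    (ae_of_all _ fun y => ?_)
  rw [norm_mul]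
  exact mul_le_of_le_one_right (norm_nonneg _) (norm_translation_le hα hj1 x y)

lemma eq_of_forall_integral_gauss {α : ℝ} (hα : -(1 / 2) < α) {u v : ℝ → ℂ} (hu : Continuous u)
    (hv : Continuous v) {A B : ℝ} (hA : ∀ x, ‖u x‖ ≤ A) (hB : ∀ x, ‖v x‖ ≤ B)
    (h : ∀ s : ℝ, 0 < s →
      ∫ x, (gauss s x : ℂ) * u x ∂(mu α) = ∫ x, (gauss s x : ℂ) * v x ∂(mu α))
    {x : ℝ} (hx : 0 < x) : u x = v x := by
  have hI : ∀ s : ℝ, 0 < s → Integrable (fun x => (gauss s x : ℂ) * u x) (mu α) := fun s hs =>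
    integrable_gauss_mul hα hs hu.aestronglyMeasurable hA
  have hI2 : ∀ s : ℝ, 0 < s → Integrable (fun x => (gauss s x : ℂ) * v x) (mu α) := fun s hs =>
    integrable_gauss_mul hα hs hv.aestronglyMeasurable hB
  rw [← sub_eq_zero]
  refine eq_zero_of_ae_mu hα (h := fun x => u x - v x) (hu.sub hv)
    (ae_eq_zero_of_forall_integral_gauss ?_ fun s hs => ?_) hx
  · simp_rw [mul_sub]
    exact (hI 1 one_pos).sub (hI2 1 one_pos)
  · simp_rw [mul_sub]
    rw [integral_sub (hI s hs) (hI2 s hs), h s hs, sub_self]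

/-- Both sides have the same integrals against `gauss s x * gauss t y`: for the translation these
are Hankel transforms of convolutions of Gaussians. -/
theorem translation_besselj {α : ℝ} (hα : -(1 / 2) < α) (ξ : ℝ) {x y : ℝ} (hx : 0 < x)
    (hy : 0 < y) : translation α x (fun y => (besselj α (y * ξ) : ℂ)) y =
      (besselj α (x * ξ) : ℂ) * (besselj α (y * ξ) : ℂ) := by
  obtain ⟨j, hj⟩ : ∃ j : ℝ → ℂ, ∀ y, j y = (besselj α (y * ξ) : ℂ) := ⟨_, fun _ => rfl⟩
  simp_rw [← hj]
  have hjc : Continuous j := by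
    have := continuous_besselj hα
    rw [funext hj]
    fun_prop
  have hj1 : ∀ y, ‖j y‖ ≤ 1 := fun y => by
    rw [hj]
    exact norm_besselj_le_one hα _
  have hgj : ∀ s : ℝ, 0 < s → ∫ x, (gauss s x : ℂ) * j x ∂(mu α) =
      ((s ^ (-(α + 1)) * gauss s⁻¹ ξ : ℝ) : ℂ) := by
    intro s hs
    rw [← integral_gauss_mul_besselj hα hs, ← integral_complex_ofReal]
    simp only [hj, Complex.ofReal_mul]
  have hjmul : ∀ c : ℂ, ∀ x, ‖j x * c‖ ≤ ‖c‖ := fun c x => by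
    rw [norm_mul]
    exact mul_le_of_le_one_left (norm_nonneg _) (hj1 x)
  have hTx := continuous_translation hα hjc hj1 (continuous_const (y := x)) continuous_id'
  simp_rw [mul_comm (j x)]
  refine eq_of_forall_integral_gauss hα hTx (v := fun y => j y * j x) (by fun_prop)
    (norm_translation_le hα hj1 x) (hjmul (j x)) (fun t ht => ?_) hy
  simp_rw [← mul_assoc]
  rw [integral_mul_const, mul_comm]
  refine eq_of_forall_integral_gauss hα
    (v := fun x => j x * ∫ y, (gauss t y : ℂ) * j y ∂(mu α))
    (continuous_integral_gauss_mul_translation hα ht hjc hj1) (by fun_prop)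
    (norm_integral_gauss_mul_translation_le hα ht hj1) (hjmul _) (fun s hs => ?_) hx
  have hst : 0 < s * t / (s + t) := by positivity
  simp_rw [← mul_assoc]
  rw [integral_gauss_mul_integral_gauss_mul_translation hα hs ht hjc hj1, integral_mul_const,
    hgj _ hst, hgj s hs, hgj t ht, ← Complex.ofReal_mul, ← Complex.ofReal_mul,
    Complex.ofReal_inj, ← mul_assoc, ← mul_rpow (by positivity) hst.le,
    show (s + t) * (s * t / (s + t)) = s * t by field_simp, mul_rpow hs.le ht.le,
    show (s * t / (s + t))⁻¹ = s⁻¹ + t⁻¹ by field_simp; ring, ← gauss_mul_gauss]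
  ring

/-- The Hankel transform turns translations into multiplications. -/
theorem hankel_translation {α : ℝ} (hα : -(1 / 2) < α) {φ : ℝ → ℂ} (hφ : Integrable φ (mu α))
    {x : ℝ} (hx : 0 < x) (ξ : ℝ) :
    hankel α (translation α x φ) ξ = (besselj α (x * ξ) : ℂ) * hankel α φ ξ := by
  have hjc : Continuous fun y => (besselj α (y * ξ) : ℂ) := by
    have := continuous_besselj hα
    fun_prop
  rw [hankel, integral_translation_mul hα x hφ hjc fun y => norm_besselj_le_one hα _, hankel,
    ← integral_const_mul]
  refine integral_congr_ae ?_
  filter_upwards [ae_mu_pos α] with y hy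
  rw [translation_besselj hα ξ hx hy]
  ring

/-! ### The Plancherel theorem for the Hankel transform -/

/-- A map preserving inner products on a family with dense span extends to a linear isometry. -/
theorem exists_linearIsometry_of_inner_eq {ι E F : Type*} [NormedAddCommGroup E]
    [InnerProductSpace ℂ E] [NormedAddCommGroup F] [InnerProductSpace ℂ F] [CompleteSpace F]
    {v : ι → E} {w : ι → F} (h : ∀ i k, inner ℂ (v i) (v k) = inner ℂ (w i) (w k))
    (hd : (Submodule.span ℂ (range v)).topologicalClosure = ⊤) :
    ∃ U : E →ₗᵢ[ℂ] F, ∀ i, U (v i) = w i := by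
  classical
  set A := Finsupp.linearCombination ℂ v with hA
  set B := Finsupp.linearCombination ℂ w with hB
  have hnorm : ∀ c, ‖B c‖ = ‖A c‖ := by
    intro c
    have : inner ℂ (B c) (B c) = inner ℂ (A c) (A c) := by
      simp only [hA, hB, Finsupp.linearCombination_apply, Finsupp.sum, sum_inner, inner_sum,
        inner_smul_left, inner_smul_right, h]
    rw [inner_self_eq_norm_sq_to_K, inner_self_eq_norm_sq_to_K] at this
    exact (sq_eq_sq₀ (norm_nonneg _) (norm_nonneg _)).1 (by exact_mod_cast this)
  have hdense : DenseRange A := by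
    have := (Submodule.dense_iff_topologicalClosure_eq_top).2 hd
    rw [← Finsupp.range_linearCombination] at this
    exact this
  have hb : ∃ C, ∀ c, ‖B c‖ ≤ C * ‖A c‖ := ⟨1, fun c => by rw [hnorm, one_mul]⟩
  have hext := LinearMap.extendOfNorm_eq hdense hb
  refine ⟨⟨(B.extendOfNorm A).toLinearMap, fun x => ?_⟩, fun i => ?_⟩
  · refine hdense.induction_on (p := fun x => ‖B.extendOfNorm A x‖ = ‖x‖) x
      (isClosed_eq (by fun_prop) (by fun_prop)) fun c => ?_
    rw [hext, hnorm]
  · have := hext (Finsupp.single i 1)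
    simpa [hA, hB] using this

lemma memLp_gauss {α : ℝ} (hα : -(1 / 2) < α) {s : ℝ} (hs : 0 < s) :
    MemLp (fun x => (gauss s x : ℂ)) 2 (mu α) := by
  rw [memLp_two_iff_integrable_sq_norm (continuous_ofReal_gauss s).aestronglyMeasurable]
  refine (integrable_gauss hα (add_pos hs hs)).congr (ae_of_all _ fun x => ?_)
  simp only [Complex.norm_real]
  rw [Real.norm_of_nonneg (gauss_pos s x).le, sq, gauss_mul_gauss]

lemma inner_toLp_gauss {α : ℝ} (hα : -(1 / 2) < α) {s : ℝ} (hs : 0 < s)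
    (F : Lp ℂ 2 (mu α)) :
    inner ℂ ((memLp_gauss hα hs).toLp _) F = ∫ x, (gauss s x : ℂ) * F x ∂(mu α) := by
  rw [L2.inner_def]
  refine integral_congr_ae ?_
  filter_upwards [(memLp_gauss hα hs).coeFn_toLp] with x hx
  rw [hx, RCLike.inner_apply, Complex.conj_ofReal, mul_comm]

lemma inner_toLp_gauss_toLp_gauss {α : ℝ} (hα : -(1 / 2) < α) {s t : ℝ} (hs : 0 < s)
    (ht : 0 < t) :
    inner ℂ ((memLp_gauss hα hs).toLp _) ((memLp_gauss hα ht).toLp _) =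
      (((s + t) ^ (-(α + 1)) : ℝ) : ℂ) := by
  rw [inner_toLp_gauss hα hs, ← integral_gauss hα (add_pos hs ht), ← integral_complex_ofReal]
  refine integral_congr_ae ?_
  filter_upwards [(memLp_gauss hα ht).coeFn_toLp] with x hx
  rw [hx, ← gauss_mul_gauss, Complex.ofReal_mul]

lemma integrable_gauss_mul_Lp {α : ℝ} (hα : -(1 / 2) < α) {s : ℝ} (hs : 0 < s)
    (F : Lp ℂ 2 (mu α)) : Integrable (fun x => (gauss s x : ℂ) * F x) (mu α) :=
  (memLp_gauss hα hs).integrable_mul (Lp.memLp F)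

/-- On Gaussians the Hankel transform is given explicitly and preserves inner products. -/
theorem exists_linearIsometry_gauss {α : ℝ} (hα : -(1 / 2) < α) :
    ∃ U : Lp ℂ 2 (mu α) →ₗᵢ[ℂ] Lp ℂ 2 (mu α), ∀ s : ℝ, ∀ hs : 0 < s,
      U ((memLp_gauss hα hs).toLp _) =
        ((s ^ (-(α + 1)) : ℝ) : ℂ) • (memLp_gauss hα (inv_pos.2 hs)).toLp _ := by
  obtain ⟨U, hU⟩ := exists_linearIsometry_of_inner_eq (ι := {s : ℝ // 0 < s})
    (v := fun s => (memLp_gauss hα s.2).toLp _)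
    (w := fun s => ((s.1 ^ (-(α + 1)) : ℝ) : ℂ) • (memLp_gauss hα (inv_pos.2 s.2)).toLp _)
    (fun ⟨s, hs⟩ ⟨t, ht⟩ => by
      have hs' := inv_pos.2 hs
      have ht' := inv_pos.2 ht
      rw [inner_smul_left, inner_smul_right, inner_toLp_gauss_toLp_gauss hα hs ht,
        inner_toLp_gauss_toLp_gauss hα hs' ht', Complex.conj_ofReal, ← Complex.ofReal_mul,
        ← Complex.ofReal_mul, Complex.ofReal_inj, ← mul_rpow ht.le (by positivity),
        ← mul_rpow hs.le (by positivity)]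
      congr 1
      field_simp
      ring)
    (by
      rw [Submodule.topologicalClosure_eq_top_iff, Submodule.eq_bot_iff]
      intro F hF
      have h0 : (F : ℝ → ℂ) =ᵐ[mu α] 0 :=
        ae_eq_zero_of_forall_integral_gauss (integrable_gauss_mul_Lp hα one_pos F) fun s hs => by
          rw [← inner_toLp_gauss hα hs]
          exact hF _ (Submodule.subset_span ⟨⟨s, hs⟩, rfl⟩)
      exact (Lp.eq_zero_iff_ae_eq_zero).2 h0)
  exact ⟨U, fun s hs => hU ⟨s, hs⟩⟩

lemma norm_mul_besselj_le {α : ℝ} (hα : -(1 / 2) < α) (z : ℂ) (x : ℝ) :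
    ‖z * (besselj α x : ℂ)‖ ≤ ‖z‖ := by
  rw [norm_mul]
  exact mul_le_of_le_one_right (norm_nonneg _) (norm_besselj_le_one hα x)

lemma norm_hankel_le {α : ℝ} (hα : -(1 / 2) < α) {φ : ℝ → ℂ} (hφ : Integrable φ (mu α)) (ξ : ℝ) :
    ‖hankel α φ ξ‖ ≤ ∫ x, ‖φ x‖ ∂(mu α) :=
  norm_integral_le_of_norm_le hφ.norm (ae_of_all _ fun _ => norm_mul_besselj_le hα _ _)

lemma continuous_hankel {α : ℝ} (hα : -(1 / 2) < α) {φ : ℝ → ℂ} (hφ : Integrable φ (mu α)) :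
    Continuous (hankel α φ) := by
  unfold hankel
  have := continuous_besselj hα
  refine continuous_of_dominated (bound := fun x => ‖φ x‖) (fun ξ => ?_)
    (fun ξ => ae_of_all _ fun _ => norm_mul_besselj_le hα _ _) hφ.norm
    (ae_of_all _ fun x => by fun_prop)
  exact hφ.1.mul (Continuous.aestronglyMeasurable (by fun_prop))

lemma integral_gauss_mul_hankel {α : ℝ} (hα : -(1 / 2) < α) {φ : ℝ → ℂ}
    (hφ : Integrable φ (mu α)) {s : ℝ} (hs : 0 < s) :
    ∫ ξ, (gauss s ξ : ℂ) * hankel α φ ξ ∂(mu α) =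
      ((s ^ (-(α + 1)) : ℝ) : ℂ) * ∫ x, (gauss s⁻¹ x : ℂ) * φ x ∂(mu α) := by
  have hj := continuous_besselj hα
  simp_rw [hankel, ← integral_const_mul]
  rw [integral_integral_swap]
  · refine integral_congr_ae (ae_of_all _ fun x => ?_)
    have h := integral_gauss_mul_besselj hα hs x
    have e : ∀ ξ, (gauss s ξ : ℂ) * (φ x * (besselj α (x * ξ) : ℂ)) =
        φ x * ((gauss s ξ * besselj α (ξ * x) : ℝ) : ℂ) := fun ξ => by
      rw [mul_comm x ξ]
      push_cast
      ring
    simp_rw [e]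
    rw [integral_const_mul, integral_complex_ofReal, h]
    push_cast
    ring
  · have := (integrable_ofReal_gauss hα hs).mul_prod hφ
    have h2 := this.mul_bdd (c := 1) (g := fun p : ℝ × ℝ => (besselj α (p.2 * p.1) : ℂ))
      (Continuous.aestronglyMeasurable (by fun_prop))
      (ae_of_all _ fun p => norm_besselj_le_one hα _)
    simpa only [mul_assoc, Function.uncurry_def] using h2

/-- The isometry `U` of `L²` agrees with the Hankel transform on `L¹ ∩ L²`. -/
def ExtendsHankel {α : ℝ} (U : Lp ℂ 2 (mu α) →ₗᵢ[ℂ] Lp ℂ 2 (mu α)) : Prop :=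
  ∀ (φ : ℝ → ℂ) (h2 : MemLp φ 2 (mu α)), Integrable φ (mu α) →
    U (h2.toLp φ) =ᵐ[mu α] hankel α φ

/-- The Hankel transform extends from `L¹ ∩ L²` to an isometry of `L²`. -/
theorem exists_plancherel {α : ℝ} (hα : -(1 / 2) < α) :
    ∃ U : Lp ℂ 2 (mu α) →ₗᵢ[ℂ] Lp ℂ 2 (mu α), ExtendsHankel U := by
  obtain ⟨U, hU⟩ := exists_linearIsometry_gauss hα
  refine ⟨U, fun φ h2 h1 => ?_⟩
  have hH : ∀ s : ℝ, 0 < s → Integrable (fun x => (gauss s x : ℂ) * hankel α φ x) (mu α) :=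
    fun s hs => integrable_gauss_mul hα hs (continuous_hankel hα h1).aestronglyMeasurable
      (norm_hankel_le hα h1)
  have hUI := fun (s : ℝ) (hs : 0 < s) => integrable_gauss_mul_Lp hα hs (U (h2.toLp φ))
  have key : (fun x => U (h2.toLp φ) x - hankel α φ x) =ᵐ[mu α] 0 := by
    refine ae_eq_zero_of_forall_integral_gauss ?_ fun s hs => ?_
    · simp_rw [mul_sub]
      exact (hUI 1 one_pos).sub (hH 1 one_pos)
    · simp_rw [mul_sub]
      rw [integral_sub (hUI s hs) (hH s hs), sub_eq_zero, integral_gauss_mul_hankel hα h1 hs,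
        ← inner_toLp_gauss hα hs]
      have hs' := inv_pos.2 hs
      -- the Gaussian is itself in the range of `U`
      have e : (memLp_gauss hα hs).toLp _ =
          ((s ^ (-(α + 1)) : ℝ) : ℂ) • U ((memLp_gauss hα hs').toLp _) := by
        rw [hU _ hs', smul_smul, ← Complex.ofReal_mul, ← mul_rpow hs.le hs'.le,
          mul_inv_cancel₀ hs.ne', one_rpow, Complex.ofReal_one, one_smul]
        simp only [inv_inv]
      rw [e, inner_smul_left, LinearIsometry.inner_map_map, Complex.conj_ofReal,
        inner_toLp_gauss hα hs']
      congr 1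
      refine integral_congr_ae ?_
      filter_upwards [h2.coeFn_toLp] with x hx
      rw [hx]
  filter_upwards [key] with x hx
  exact sub_eq_zero.1 hx

lemma eLpNorm_hankel {α : ℝ} {U : Lp ℂ 2 (mu α) →ₗᵢ[ℂ] Lp ℂ 2 (mu α)} (hU : ExtendsHankel U)
    {φ : ℝ → ℂ} (h1 : Integrable φ (mu α)) (h2 : MemLp φ 2 (mu α)) :
    eLpNorm (hankel α φ) 2 (mu α) = eLpNorm φ 2 (mu α) := by
  rw [← eLpNorm_congr_ae (hU φ h2 h1), ← Lp.enorm_def, ← ofReal_norm, LinearIsometry.norm_map,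
    ofReal_norm, Lp.enorm_toLp]

/-! ### Dilations -/

/-- The measure `μ_α` is homogeneous of degree `2α + 2`. -/
lemma mu_eq_smul_map {α : ℝ} (hα : -(1 / 2) < α) {a : ℝ} (ha : 0 < a) :
    mu α = ENNReal.ofReal (a ^ (2 * α + 2)) • (mu α).map (fun x => a * x) := by
  have hG := Real.Gamma_pos_of_pos (show 0 < α + 1 by linarith)
  refine Measure.ext_of_lintegral _ fun h hh => ?_
  have hm : Measurable fun x : ℝ => a * x := by fun_prop
  have himg : (fun x : ℝ => a * x) '' Ioi 0 = Ioi 0 := by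
    ext y
    constructor
    · rintro ⟨x, hx, rfl⟩
      exact mul_pos ha hx
    · intro hy
      exact ⟨y / a, div_pos hy ha, by field_simp⟩
  rw [lintegral_smul_measure, lintegral_map hh hm, mu_eq_restrict_Ioi,
    lintegral_withDensity_eq_lintegral_mul _ (by fun_prop) hh,
    lintegral_withDensity_eq_lintegral_mul _ (by fun_prop)
      (show Measurable fun x => h (a * x) from hh.comp hm), smul_eq_mul,
    ← lintegral_const_mul _ (by fun_prop)]
  conv_lhs => rw [← himg]
  rw [lintegral_image_eq_lintegral_abs_deriv_mul measurableSet_Ioi (f' := fun _ => a)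
    (fun x _ => by simpa using ((hasDerivAt_id x).const_mul a).hasDerivWithinAt)
    (mul_right_injective₀ ha.ne').injOn]
  refine setLIntegral_congr_fun measurableSet_Ioi fun x hx => ?_
  have hx : 0 < x := hx
  simp only [Pi.mul_apply]
  rw [← mul_assoc, ← mul_assoc, abs_of_pos ha, ← ENNReal.ofReal_mul ha.le,
    ← ENNReal.ofReal_mul (by positivity), mul_rpow ha.le hx.le,
    show 2 * α + 2 = (2 * α + 1) + 1 by ring, rpow_add ha (2 * α + 1), rpow_one]
  congr 2
  ring

lemma map_mul_left_mu {α : ℝ} (hα : -(1 / 2) < α) {a : ℝ} (ha : 0 < a) :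
    (mu α).map (fun x => a * x) = ENNReal.ofReal (a ^ (-(2 * α + 2))) • mu α := by
  conv_rhs => rw [mu_eq_smul_map hα ha]
  rw [smul_smul, ← ENNReal.ofReal_mul (by positivity), ← rpow_add ha, neg_add_cancel, rpow_zero,
    ENNReal.ofReal_one, one_smul]

lemma memLp_dilation {α : ℝ} (hα : -(1 / 2) < α) {a : ℝ} (ha : 0 < a) {p : ℝ≥0∞} {ψ : ℝ → ℂ}
    (hψ : MemLp ψ p (mu α)) : MemLp (dilation α a ψ) p (mu α) := by
  have h : MemLp ψ p ((mu α).map fun x => a * x) := by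
    rw [map_mul_left_mu hα ha]
    exact hψ.smul_measure ENNReal.ofReal_ne_top
  exact (h.comp_of_map (by fun_prop)).const_mul _

lemma eLpNorm_two_dilation {α : ℝ} (hα : -(1 / 2) < α) {a : ℝ} (ha : 0 < a) {ψ : ℝ → ℂ}
    (hψ : MemLp ψ 2 (mu α)) : eLpNorm (dilation α a ψ) 2 (mu α) = eLpNorm ψ 2 (mu α) := by
  have h : AEStronglyMeasurable ψ ((mu α).map fun x => a * x) := by
    rw [map_mul_left_mu hα ha]
    exact hψ.1.smul_measure _
  have e := eLpNorm_map_measure (p := 2) h (f := fun x => a * x) (by fun_prop)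
  rw [map_mul_left_mu hα ha, eLpNorm_smul_measure_of_ne_top (by norm_num)] at e
  rw [show dilation α a ψ = ((a ^ (α + 1) : ℝ) : ℂ) • (ψ ∘ fun x => a * x) from rfl,
    eLpNorm_const_smul, ← e, smul_eq_mul, ← mul_assoc]
  have : ‖((a ^ (α + 1) : ℝ) : ℂ)‖ₑ *
      ENNReal.ofReal (a ^ (-(2 * α + 2))) ^ (1 / (2 : ℝ≥0∞)).toReal = 1 := by
    rw [← ofReal_norm, Complex.norm_real, Real.norm_of_nonneg (by positivity),
      ENNReal.ofReal_rpow_of_pos (by positivity), ← ENNReal.ofReal_mul (by positivity),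
      ← rpow_mul ha.le, ← rpow_add ha, ENNReal.toReal_div, ENNReal.toReal_one, ENNReal.toReal_ofNat,
      show α + 1 + -(2 * α + 2) * (1 / 2) = 0 by ring, rpow_zero, ENNReal.ofReal_one]
  rw [this, one_mul]

lemma hankel_dilation {α : ℝ} (hα : -(1 / 2) < α) {a : ℝ} (ha : 0 < a) (ψ : ℝ → ℂ) (ξ : ℝ) :
    hankel α (dilation α a ψ) ξ = ((a ^ (-(α + 1)) : ℝ) : ℂ) * hankel α ψ (ξ / a) := by
  have hemb : MeasurableEmbedding fun x : ℝ => a * x :=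
    (Homeomorph.mulLeft₀ a ha.ne').measurableEmbedding
  have h := hemb.integral_map (μ := mu α) fun x => ψ x * (besselj α (x * (ξ / a)) : ℂ)
  rw [map_mul_left_mu hα ha, integral_smul_measure,
    ENNReal.toReal_ofReal (by positivity)] at h
  have e : ∀ x, dilation α a ψ x * (besselj α (x * ξ) : ℂ) = ((a ^ (α + 1) : ℝ) : ℂ) *
      (ψ (a * x) * (besselj α (a * x * (ξ / a)) : ℂ)) := fun x => by
    rw [dilation, mul_assoc, show a * x * (ξ / a) = x * ξ by field_simp]
  rw [hankel]
  simp_rw [e]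
  rw [integral_const_mul, ← h, Complex.real_smul, ← mul_assoc, ← Complex.ofReal_mul,
    ← rpow_add ha, show α + 1 + -(2 * α + 2) = -(α + 1) by ring, hankel]

lemma memLp_two_of_memLp_one_of_memLp_top {X : Type*} [MeasurableSpace X] {m : Measure X}
    {φ : X → ℂ} (h1 : MemLp φ 1 m) (h : MemLp φ ∞ m) : MemLp φ 2 m := by
  rw [memLp_two_iff_integrable_sq_norm h1.1]
  have := (memLp_one_iff_integrable.1 h1).norm.mul_of_top_right h.norm
  exact this.congr (ae_of_all _ fun x => by simp [sq])

/-! ### The wavelet transform on the Hankel side -/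

/-- The wavelet transform expressed through the Hankel transform `F` of the signal:
`c_ψ^(-1/2) H_α (F · conj (H_α (D_a ψ)))(x)`. -/
noncomputable def spectralTransform (α : ℝ) (ψ F : ℝ → ℂ) (z : ℝ × ℝ) : ℂ :=
  ((admConst α ψ ^ (-(1 / 2) : ℝ) : ℝ) : ℂ) *
    hankel α (fun ξ => F ξ *
      (starRingEnd ℂ) (((z.1 ^ (-(α + 1)) : ℝ) : ℂ) * hankel α ψ (ξ / z.1))) z.2

lemma stronglyMeasurable_spectralTransform {α : ℝ} (hα : -(1 / 2) < α) {ψ F : ℝ → ℂ}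
    (hψ : Integrable ψ (mu α)) (hF : StronglyMeasurable F) :
    StronglyMeasurable (spectralTransform α ψ F) := by
  have hH := (continuous_hankel hα hψ).measurable
  have hj := (continuous_besselj hα).measurable
  have hF := hF.measurable
  unfold spectralTransform
  refine StronglyMeasurable.const_mul ?_ _
  unfold hankel at hH ⊢
  refine StronglyMeasurable.integral_prod_right (f := fun (z : ℝ × ℝ) ξ => F ξ *
    (starRingEnd ℂ) (((z.1 ^ (-(α + 1)) : ℝ) : ℂ) *
      ∫ x, ψ x * (besselj α (x * (ξ / z.1)) : ℂ) ∂(mu α)) * (besselj α (ξ * z.2) : ℂ)) ?_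
  have hH' : Measurable fun p : (ℝ × ℝ) × ℝ =>
      ∫ x, ψ x * (besselj α (x * (p.2 / p.1.1)) : ℂ) ∂(mu α) :=
    hH.comp (by fun_prop : Measurable fun p : (ℝ × ℝ) × ℝ => p.2 / p.1.1)
  have hc := Complex.continuous_conj.measurable
  refine Measurable.stronglyMeasurable ?_
  simp only [Function.uncurry_def]
  exact ((by fun_prop : Measurable fun p : (ℝ × ℝ) × ℝ => F p.2).mul
    (hc.comp (Measurable.mul (by fun_prop) hH'))).mul (by fun_prop)

/-- Parseval's identity, applied to `f` and the translated wavelet. -/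
theorem waveletTransform_eq_spectralTransform {α : ℝ} (hα : -(1 / 2) < α) {ψ f : ℝ → ℂ}
    (h1 : MemLp ψ 1 (mu α)) (h2 : MemLp ψ 2 (mu α)) (hf : MemLp f 2 (mu α))
    {U : Lp ℂ 2 (mu α) →ₗᵢ[ℂ] Lp ℂ 2 (mu α)} (hU : ExtendsHankel U)
    {z : ℝ × ℝ} (ha : 0 < z.1) (hx : 0 < z.2) :
    waveletTransform α ψ f z = spectralTransform α ψ (U (hf.toLp f)) z := by
  obtain ⟨a, x⟩ := z
  have h1' := memLp_one_iff_integrable.1 (memLp_dilation hα ha h1)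
  have h2' := memLp_dilation hα ha h2
  have t2 := memLp_two_translation hα x h1' h2'
  have t1 := integrable_translation hα x h1'
  have e1 : waveletTransform α ψ f (a, x) = ((admConst α ψ ^ (-(1 / 2) : ℝ) : ℝ) : ℂ) *
      inner ℂ (t2.toLp _) (hf.toLp f) := by
    rw [L2.inner_def, waveletTransform, ← integral_const_mul]
    refine integral_congr_ae ?_
    filter_upwards [t2.coeFn_toLp, hf.coeFn_toLp] with t ht ht'
    rw [ht, ht', RCLike.inner_apply, atom, map_mul, Complex.conj_ofReal]
    ring
  rw [e1, ← LinearIsometry.inner_map_map U, L2.inner_def, spectralTransform]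
  congr 1
  rw [hankel]
  refine integral_congr_ae ?_
  filter_upwards [hU _ t2 t1] with ξ hξ
  rw [hξ, RCLike.inner_apply, hankel_translation hα h1' hx, hankel_dilation hα ha, map_mul,
    Complex.conj_ofReal, mul_comm x ξ]
  ring

/-! ### Energy and supremum of the wavelet transform -/

lemma eLpNorm_two_sq {X : Type*} [MeasurableSpace X] {m : Measure X} (φ : X → ℂ) :
    eLpNorm φ 2 m ^ 2 = ∫⁻ x, ‖φ x‖ₑ ^ 2 ∂m := by
  have := eLpNorm_nnreal_pow_eq_lintegral (μ := m) (f := φ) (p := 2) (by norm_num)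
  simpa using this

section

variable {α : ℝ} {U : Lp ℂ 2 (mu α) →ₗᵢ[ℂ] Lp ℂ 2 (mu α)} {ψ F : ℝ → ℂ}

/-- For fixed `a`, the function whose Hankel transform is the wavelet transform is integrable and
square integrable. -/
lemma integrable_and_memLp_mul_conj_hankel (hα : -(1 / 2) < α) (hU : ExtendsHankel U)
    (h1 : Integrable ψ (mu α)) (h2 : MemLp ψ 2 (mu α)) (hF : MemLp F 2 (mu α)) :
    Integrable (fun ξ => F ξ * (starRingEnd ℂ) (hankel α ψ ξ)) (mu α) ∧
      MemLp (fun ξ => F ξ * (starRingEnd ℂ) (hankel α ψ ξ)) 2 (mu α) := by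
  have hm : AEStronglyMeasurable (fun ξ => (starRingEnd ℂ) (hankel α ψ ξ)) (mu α) :=
    (Complex.continuous_conj.comp (continuous_hankel hα h1)).aestronglyMeasurable
  have hH : MemLp (fun ξ => (starRingEnd ℂ) (hankel α ψ ξ)) 2 (mu α) := by
    refine (memLp_congr_norm hm (continuous_hankel hα h1).aestronglyMeasurable
      (ae_of_all _ fun ξ => RCLike.norm_conj _)).2
      ⟨(continuous_hankel hα h1).aestronglyMeasurable, ?_⟩
    rw [eLpNorm_hankel hU h1 h2]
    exact h2.2
  refine ⟨hF.integrable_mul hH, hF.of_le_mul (c := ∫ x, ‖ψ x‖ ∂(mu α)) (hF.1.mul hm)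
    (ae_of_all _ fun ξ => ?_)⟩
  rw [norm_mul, RCLike.norm_conj, mul_comm]
  gcongr
  exact norm_hankel_le hα h1 ξ

lemma enorm_hankel_mul_conj_hankel_le (hα : -(1 / 2) < α) (hU : ExtendsHankel U)
    (h1 : Integrable ψ (mu α)) (h2 : MemLp ψ 2 (mu α)) (hF : MemLp F 2 (mu α)) (x : ℝ) :
    ‖hankel α (fun ξ => F ξ * (starRingEnd ℂ) (hankel α ψ ξ)) x‖ₑ ≤
      eLpNorm F 2 (mu α) * eLpNorm ψ 2 (mu α) := by
  have hm : AEStronglyMeasurable (fun ξ => (starRingEnd ℂ) (hankel α ψ ξ)) (mu α) :=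
    (Complex.continuous_conj.comp (continuous_hankel hα h1)).aestronglyMeasurable
  have hn : eLpNorm (fun ξ => (starRingEnd ℂ) (hankel α ψ ξ)) 2 (mu α) =
      eLpNorm ψ 2 (mu α) := by
    rw [← eLpNorm_hankel hU h1 h2]
    exact eLpNorm_congr_norm_ae (ae_of_all _ fun ξ => RCLike.norm_conj _)
  have hol := eLpNorm_smul_le_mul_eLpNorm (p := 2) (q := 2) (r := 1) hm hF.1
  rw [hn] at hol
  refine le_trans ?_ hol
  rw [eLpNorm_one_eq_lintegral_enorm]
  refine (enorm_integral_le_lintegral_enorm _).trans (lintegral_mono fun ξ => ?_)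
  rw [← ofReal_norm, ← ofReal_norm]
  exact ENNReal.ofReal_le_ofReal (norm_mul_besselj_le hα _ _)

/-- Admissibility, after the substitution `a ↦ ξ / a`. -/
lemma lintegral_hankel_div (hψ : IsAdmissible α ψ) {ξ : ℝ} (hξ : 0 < ξ) :
    ∫⁻ a in Ioi (0 : ℝ), ENNReal.ofReal a⁻¹ * ‖hankel α ψ (ξ / a)‖ₑ ^ 2 =
      ENNReal.ofReal (admConst α ψ) := by
  have himg : (fun a : ℝ => ξ / a) '' Ioi 0 = Ioi 0 := by
    ext y
    constructor
    · rintro ⟨x, hx, rfl⟩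
      exact div_pos hξ hx
    · intro hy
      have hy : 0 < y := hy
      exact ⟨ξ / y, div_pos hξ hy, by field_simp⟩
  rw [admConst, ofReal_integral_eq_lintegral_ofReal hψ.const_finite]
  · conv_rhs => rw [← himg]
    rw [lintegral_image_eq_lintegral_abs_deriv_mul measurableSet_Ioi
      (f' := fun a => ξ * -(a ^ 2)⁻¹)
      (fun a ha => by
        simpa only [div_eq_mul_inv] using
          ((hasDerivAt_inv (ne_of_gt ha)).const_mul ξ).hasDerivWithinAt)
      (fun a _ b _ hab => by
        simpa [div_eq_mul_inv, hξ.ne'] using hab)]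
    refine setLIntegral_congr_fun measurableSet_Ioi fun a ha => ?_
    have ha : 0 < a := ha
    rw [← ofReal_norm, ← ENNReal.ofReal_pow (norm_nonneg _), ← ENNReal.ofReal_mul (by positivity),
      ← ENNReal.ofReal_mul (by positivity), mul_neg, abs_neg, abs_of_pos (by positivity)]
    congr 1
    field_simp
  · refine (ae_restrict_mem measurableSet_Ioi).mono fun a ha => ?_
    have ha : 0 < a := ha
    simp only [Pi.zero_apply]
    positivity

/-- The `x`-integral is evaluated by Plancherel's theorem, the `a`-integral by admissibility. -/
theorem lintegral_spectralTransform_sq (hα : -(1 / 2) < α) (hU : ExtendsHankel U)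
    (hψ : IsAdmissible α ψ) (hF : MemLp F 2 (mu α)) (hFm : StronglyMeasurable F) :
    ∫⁻ z, ‖spectralTransform α ψ F z‖ₑ ^ 2 ∂(nu α) = ∫⁻ ξ, ‖F ξ‖ₑ ^ 2 ∂(mu α) := by
  have h1 := hψ.memLp_one
  have h1i := memLp_one_iff_integrable.1 h1
  have h2 := memLp_two_of_memLp_one_of_memLp_top h1 hψ.memLp_top
  have hc := hψ.const_pos
  set κ : ℝ≥0∞ := ENNReal.ofReal (admConst α ψ)⁻¹ with hκ
  have hmeas := (stronglyMeasurable_spectralTransform hα h1i hFm).measurable.enorm.pow_const 2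
  have hHm := (continuous_hankel hα h1i).measurable
  have hFm' := hFm.measurable
  have inner_eq : ∀ a : ℝ, 0 < a →
      ∫⁻ x, ‖spectralTransform α ψ F (a, x)‖ₑ ^ 2 ∂(mu α) =
        ∫⁻ ξ, κ * (ENNReal.ofReal (a ^ (-(2 * α + 2))) *
          (‖F ξ‖ₑ ^ 2 * ‖hankel α ψ (ξ / a)‖ₑ ^ 2)) ∂(mu α) := by
    intro a ha
    have d1 := memLp_one_iff_integrable.1 (memLp_dilation hα ha h1)
    have d2 := memLp_dilation hα ha h2
    obtain ⟨g1, g2⟩ := integrable_and_memLp_mul_conj_hankel hα hU d1 d2 hF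
    have e : ∀ x, ‖spectralTransform α ψ F (a, x)‖ₑ ^ 2 = κ * ‖hankel α
        (fun ξ => F ξ * (starRingEnd ℂ) (hankel α (dilation α a ψ) ξ)) x‖ₑ ^ 2 := by
      intro x
      simp_rw [hankel_dilation hα ha]
      rw [spectralTransform, enorm_mul, mul_pow, ← ofReal_norm (E := ℂ) (_ : ℂ), Complex.norm_real,
        Real.norm_of_nonneg (by positivity), ← ENNReal.ofReal_pow (by positivity), ← rpow_natCast,
        ← rpow_mul hc.le]
      norm_num [rpow_neg_one, hκ]
    simp_rw [e]
    rw [lintegral_const_mul' _ _ ENNReal.ofReal_ne_top, ← eLpNorm_two_sq,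
      eLpNorm_hankel hU g1 g2, eLpNorm_two_sq, ← lintegral_const_mul' _ _ ENNReal.ofReal_ne_top]
    refine lintegral_congr fun ξ => ?_
    congr 1
    rw [hankel_dilation hα ha, enorm_mul, RCLike.enorm_conj, enorm_mul, mul_pow, mul_pow,
      ← ofReal_norm (E := ℂ) ((a ^ (-(α + 1)) : ℝ) : ℂ), Complex.norm_real,
      Real.norm_of_nonneg (by positivity), ← ENNReal.ofReal_pow (by positivity), ← rpow_natCast,
      ← rpow_mul ha.le, show -(α + 1) * ((2 : ℕ) : ℝ) = -(2 * α + 2) by push_cast; ring]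
    ring
  have hm1 : Measurable fun a : ℝ =>
      ∫⁻ x, ‖spectralTransform α ψ F (a, x)‖ₑ ^ 2 ∂(mu α) := hmeas.lintegral_prod_right'
  rw [nu, lintegral_prod _ hmeas.aemeasurable,
    lintegral_withDensity_eq_lintegral_mul _ (by fun_prop) hm1]
  have step : ∀ a ∈ Ioi (0 : ℝ), ((fun a => ENNReal.ofReal (a ^ (2 * α + 1))) *
      fun a => ∫⁻ x, ‖spectralTransform α ψ F (a, x)‖ₑ ^ 2 ∂(mu α)) a =
      ∫⁻ ξ, κ * ‖F ξ‖ₑ ^ 2 * (ENNReal.ofReal a⁻¹ * ‖hankel α ψ (ξ / a)‖ₑ ^ 2) ∂(mu α) := by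
    intro a ha
    have ha : 0 < a := ha
    rw [Pi.mul_apply, inner_eq a ha, ← lintegral_const_mul' _ _ ENNReal.ofReal_ne_top]
    refine lintegral_congr fun ξ => ?_
    have : ENNReal.ofReal a⁻¹ =
        ENNReal.ofReal (a ^ (2 * α + 1)) * ENNReal.ofReal (a ^ (-(2 * α + 2))) := by
      rw [← ENNReal.ofReal_mul (by positivity), ← rpow_add ha,
        show 2 * α + 1 + -(2 * α + 2) = -1 by ring, rpow_neg_one]
    rw [this]
    ring
  rw [setLIntegral_congr_fun measurableSet_Ioi step, lintegral_lintegral_swap]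
  · refine lintegral_congr_ae ?_
    filter_upwards [ae_mu_pos α] with ξ hξ
    rw [lintegral_const_mul' _ _ (ENNReal.mul_ne_top ENNReal.ofReal_ne_top (by simp)),
      lintegral_hankel_div hψ hξ, mul_right_comm, ← ENNReal.ofReal_mul (by positivity),
      inv_mul_cancel₀ hc.ne', ENNReal.ofReal_one, one_mul]
  · refine Measurable.aemeasurable ?_
    have hH' : Measurable fun p : ℝ × ℝ => hankel α ψ (p.2 / p.1) := hHm.comp (by fun_prop)
    simp only [Function.uncurry_def]
    fun_prop

end

lemma ae_nu_pos (α : ℝ) : ∀ᵐ z ∂(nu α), 0 < z.1 ∧ 0 < z.2 := by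
  have h1 : ∀ᵐ a ∂((volume.restrict (Ioi (0 : ℝ))).withDensity
      fun a => ENNReal.ofReal (a ^ (2 * α + 1))), 0 < a :=
    (withDensity_absolutelyContinuous _ _).ae_le (ae_restrict_mem measurableSet_Ioi)
  exact (Measure.quasiMeasurePreserving_fst.ae h1).and
    (Measure.quasiMeasurePreserving_snd.ae (ae_mu_pos α))

lemma norm2_sq {α : ℝ} {f : ℝ → ℂ} (hf : MemLp f 2 (mu α)) :
    ENNReal.ofReal (norm2 α f ^ 2) = eLpNorm f 2 (mu α) ^ 2 := by
  rw [norm2, ENNReal.ofReal_pow ENNReal.toReal_nonneg, ENNReal.ofReal_toReal hf.2.ne]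

/-- The density `|W_ψ f|²` has total mass `‖f‖²` and is bounded by `‖f‖² ‖ψ‖² / c_ψ`. -/
theorem waveletTransform_energy_and_bound {α : ℝ} (hα : -(1 / 2) < α) {ψ f : ℝ → ℂ}
    (hψ : IsAdmissible α ψ) (hf : MemLp f 2 (mu α)) :
    AEMeasurable (fun z => ‖waveletTransform α ψ f z‖ ^ 2) (nu α) ∧
    ∫⁻ z, ENNReal.ofReal (‖waveletTransform α ψ f z‖ ^ 2) ∂(nu α) =
      ENNReal.ofReal (norm2 α f ^ 2) ∧
    ∀ᵐ z ∂(nu α), ‖waveletTransform α ψ f z‖ ^ 2 ≤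
      norm2 α ψ ^ 2 * norm2 α f ^ 2 / admConst α ψ := by
  obtain ⟨U, hU⟩ := exists_plancherel hα
  have h1 := hψ.memLp_one
  have h1i := memLp_one_iff_integrable.1 h1
  have h2 := memLp_two_of_memLp_one_of_memLp_top h1 hψ.memLp_top
  have hc := hψ.const_pos
  set F : ℝ → ℂ := ((U (hf.toLp f) : Lp ℂ 2 (mu α)) : ℝ → ℂ) with hF
  have hF2 : MemLp F 2 (mu α) := Lp.memLp _
  have hFm : StronglyMeasurable F := Lp.stronglyMeasurable _
  have hFn : eLpNorm F 2 (mu α) = eLpNorm f 2 (mu α) := by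
    rw [hF, ← Lp.enorm_def, ← ofReal_norm, LinearIsometry.norm_map, ofReal_norm, Lp.enorm_toLp]
  have hW : ∀ᵐ z ∂(nu α), waveletTransform α ψ f z = spectralTransform α ψ F z := by
    filter_upwards [ae_nu_pos α] with z hz
    exact waveletTransform_eq_spectralTransform hα h1 h2 hf hU hz.1 hz.2
  have hm := stronglyMeasurable_spectralTransform hα h1i hFm
  refine ⟨?_, ?_, ?_⟩
  · refine (hm.measurable.norm.pow_const 2).aemeasurable.congr ?_
    filter_upwards [hW] with z hz
    rw [hz]
  · rw [norm2_sq hf, ← hFn, eLpNorm_two_sq, ← lintegral_spectralTransform_sq hα hU hψ hF2 hFm]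
    refine lintegral_congr_ae ?_
    filter_upwards [hW] with z hz
    rw [hz, ← ofReal_norm, ENNReal.ofReal_pow (norm_nonneg _)]
  · filter_upwards [hW, ae_nu_pos α] with z hz hz0
    have ha := hz0.1
    have d1 := memLp_one_iff_integrable.1 (memLp_dilation hα ha h1)
    have d2 := memLp_dilation hα ha h2
    have hb := enorm_hankel_mul_conj_hankel_le hα hU d1 d2 hF2 z.2
    rw [eLpNorm_two_dilation hα ha h2, hFn] at hb
    have hb' := ENNReal.toReal_mono (ENNReal.mul_ne_top hf.2.ne h2.2.ne) hb
    rw [toReal_enorm, ENNReal.toReal_mul] at hb'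
    simp_rw [hankel_dilation hα ha] at hb'
    rw [hz, spectralTransform, norm_mul, mul_pow, Complex.norm_real,
      Real.norm_of_nonneg (by positivity), ← rpow_natCast (_ ^ _), ← rpow_mul hc.le,
      show -(1 / 2) * ((2 : ℕ) : ℝ) = -1 by norm_num, rpow_neg_one, div_eq_inv_mul]
    gcongr
    calc _ ≤ (norm2 α f * norm2 α ψ) ^ 2 := by
          gcongr
          exact hb'
      _ = norm2 α ψ ^ 2 * norm2 α f ^ 2 := by ring

/-! ### The entropy of a bounded density -/

/-- The bound `-ρ ln ρ ≥ -ρ ln M`, integrated. Where `ρ > 0` it follows from `ρ ≤ M`; where `ρ = 0`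
both sides vanish, whatever the value of `log M`, so `M = 0` needs no separate treatment. -/
theorem entropy_ge_of_le {X : Type*} [MeasurableSpace X] {m : Measure X} {ρ : X → ℝ} {A M : ℝ}
    (hm : AEMeasurable ρ m) (h0 : ∀ z, 0 ≤ ρ z) (hM : ∀ᵐ z ∂m, ρ z ≤ M) (hA : 0 ≤ A)
    (hI : ∫⁻ z, ENNReal.ofReal (ρ z) ∂m = ENNReal.ofReal A) :
    AEMeasurable (fun z => -(ρ z * log (ρ z))) m ∧
    ∫⁻ z, ENNReal.ofReal (- -(ρ z * log (ρ z))) ∂m < ∞ ∧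
    ((A * -log M : ℝ) : EReal) ≤ extIntegral m fun z => -(ρ z * log (ρ z)) := by
  have hg : AEMeasurable (fun z => -(ρ z * log (ρ z))) m := by fun_prop
  have hρ : Integrable ρ m := by
    refine ⟨hm.aestronglyMeasurable, ?_⟩
    rw [hasFiniteIntegral_iff_ofReal (ae_of_all _ h0), hI]
    exact ENNReal.ofReal_lt_top
  have hρA : ∫ z, ρ z ∂m = A := by
    rw [integral_eq_lintegral_of_nonneg_ae (ae_of_all _ h0) hρ.1, hI, ENNReal.toReal_ofReal hA]
  have hle : ∀ᵐ z ∂m, ρ z * -log M ≤ -(ρ z * log (ρ z)) := by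
    filter_upwards [hM] with z hz
    rcases (h0 z).eq_or_lt with h | h
    · simp [← h]
    · have := log_le_log h hz
      nlinarith
  have hfin : ∫⁻ z, ENNReal.ofReal (- -(ρ z * log (ρ z))) ∂m < ∞ := by
    refine lt_of_le_of_lt (lintegral_mono_ae (hle.mono fun z hz => ?_))
      (hρ.mul_const (log M)).lintegral_lt_top
    exact ENNReal.ofReal_le_ofReal (by linarith)
  refine ⟨hg, hfin, ?_⟩
  by_cases hP : ∫⁻ z, ENNReal.ofReal (-(ρ z * log (ρ z))) ∂m = ∞
  · rw [extIntegral, hP, ← ENNReal.ofReal_toReal hfin.ne, EReal.coe_ennreal_top,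
      EReal.coe_ennreal_ofReal, EReal.top_sub_coe]
    exact le_top
  · have hgi : Integrable (fun z => -(ρ z * log (ρ z))) m := by
      refine ⟨hg.aestronglyMeasurable, ?_⟩
      have hsum := ENNReal.add_lt_top.2 ⟨lt_top_iff_ne_top.2 hP, hfin⟩
      rw [← lintegral_add_left' hg.ennreal_ofReal] at hsum
      refine lt_of_le_of_lt (lintegral_mono fun z => ?_) hsum
      rw [Real.enorm_eq_ofReal_abs]
      rcases abs_choice (-(ρ z * log (ρ z))) with h | h <;> rw [h]
      exacts [le_self_add, le_add_self]
    have e := integral_eq_lintegral_pos_part_sub_lintegral_neg_part hgi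
    have hmono : ∫ z, ρ z * -log M ∂m ≤ ∫ z, -(ρ z * log (ρ z)) ∂m :=
      integral_mono_ae (hρ.mul_const _) hgi hle
    rw [integral_mul_const, hρA] at hmono
    rw [extIntegral, ← ENNReal.ofReal_toReal hP, ← ENNReal.ofReal_toReal hfin.ne,
      EReal.coe_ennreal_ofReal, EReal.coe_ennreal_ofReal, max_eq_left ENNReal.toReal_nonneg,
      max_eq_left ENNReal.toReal_nonneg, ← EReal.coe_sub, ← e]
    exact_mod_cast hmono

end HankelWavelet

theorem mainTheorem5 (α : ℝ) (hα : -(1 / 2) < α) (ψ : ℝ → ℂ)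
    (hψ : HankelWavelet.IsAdmissible α ψ)
    (hc : HankelWavelet.norm2 α ψ ^ 2 ≤ HankelWavelet.admConst α ψ)
    (f : ℝ → ℂ) (hf : MemLp f 2 (HankelWavelet.mu α)) (hf0 : ¬ f =ᵐ[HankelWavelet.mu α] 0) :
    AEMeasurable (HankelWavelet.entropyDensity α ψ f) (HankelWavelet.nu α) ∧
    (∫⁻ z, ENNReal.ofReal (-HankelWavelet.entropyDensity α ψ f z) ∂(HankelWavelet.nu α)) < ∞ ∧
    ((HankelWavelet.norm2 α f ^ 2 *
        Real.log (HankelWavelet.admConst α ψ /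
          (HankelWavelet.norm2 α ψ ^ 2 * HankelWavelet.norm2 α f ^ 2)) : ℝ) : EReal) ≤
      HankelWavelet.extIntegral (HankelWavelet.nu α) (HankelWavelet.entropyDensity α ψ f) := by
  obtain ⟨hm, hI, hM⟩ := HankelWavelet.waveletTransform_energy_and_bound hα hψ hf
  have h := HankelWavelet.entropy_ge_of_le hm (fun z => sq_nonneg _) hM (sq_nonneg _) hI
  rw [← Real.log_inv, inv_div] at h
  exact h
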